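/- Let $r\in(0,1]$ and let $E$ be a separable $r$-Banach space: a real vector space with a map $\|\cdot\|:E\to[0,\infty)$ such that $\|\lambda x\|=|\lambda|\|x\|$, $\|x\|=0$ iff $x=0$, and $\|x+y\|^r\le\|x\|^r+\|y\|^r$, which is complete and separable for the metric $\|x-y\|^r$. Let $H$ be a real Hilbert space with an orthonormal basis $(h_n)_{n\in\mathbb N}$, and let $(\gamma_n)_{n\in\mathbb N}$ be a Gaussian sequence (independent real centered standard Gaussian random variables) on a probability space $(\Omega,\mathcal F,\mathbb P)$. For $0<p<\infty$ put $\|X\|_{L^p(\Omega;E)}=(\mathbb E\|X\|^p)^{1/p}$, and for a linear operator $R:H\to E$ put $$\|R\|_{\gamma_\infty^p(H,E)}=\sup\Big\|\sum_{n=1}^N\gamma_n Ru_n\Big\|_{L^p(\Omega;E)}\in[0,\infty],$$ the supremum being over all finite orthonormal systems $u_1,\dots,u_N$ in $H$. Let $\gamma_\infty(H,E)$ be the set of $R$ with $\|R\|_{\gamma_\infty^2(H,E)}<\infty$, let $\gamma(H,E)$ be the closure in $\gamma_\infty(H,E)$, with respect to $\|\cdot\|_{\gamma^2_\infty(H,E)}$,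 of the finite rank operators $\sum_{k=1}^K\langle\cdot,g_k\rangle x_k$ ($g_k\in H$, $x_k\in E$), and for $R\in\gamma(H,E)$ write $\|R\|_{\gamma^p(H,E)}=\|R\|_{\gamma^p_\infty(H,E)}$. Write $r\wedge p=\min\{r,p\}$. Let $R:H\to E$ be a bounded linear operator. (i) $R\in\gamma_\infty(H,E)$ if and only if for some (equivalently, for all) $0<p<\infty$, $$\sup_{N}\Big\|\sum_{n=1}^N\gamma_nRh_n\Big\|_{L^p(\Omega;E)}<\infty.$$ In this case, for all $0<p<\infty$ and all $N$, $$\Big\|\sum_{n=1}^N\gamma_nRh_n\Big\|_{L^p(\Omega;E)}\le\|R\|_{\gamma^p_\infty(H,E)}\le 2^{\frac{1-(r\wedge p)}{r\wedge p}}\sup_{M}\Big\|\sum_{n=1}^M\gamma_nRh_n\Big\|_{L^p(\Omega;E)}.$$ (ii) $R\in\gamma(H,E)$ if and only if for some (equivalently, for all) $0<p<\infty$ the series $\sum_{n=1}^\infty\gamma_nRh_n$ converges in $L^p(\Omega;E)$. In this case the series also converges almost surely, to the same limit, and for all $0<p<\infty$, $$\Big\|\sum_{n=1}^\infty\gamma_nRh_n\Big\|_{L^p(\Omega;E)}\le\|R\|_{\gamma^p(H,E)}\le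 2^{\frac{1-(r\wedge p)}{r\wedge p}}\Big\|\sum_{n=1}^\infty\gamma_nRh_n\Big\|_{L^p(\Omega;E)}.$$ -/

import Mathlib

open MeasureTheory ProbabilityTheory Filter Topology
open scoped ENNReal

namespace GammaRad

/-- `E`, with its `Norm`, is an `r`-normed space, and its metric is the one induced by the `r`-norm,
`dist x y = ‖x - y‖ ^ r`. Together with `[CompleteSpace E]` this is an `r`-Banach space. -/
class IsRNormedSpace (r : ℝ) (E : Type*) [AddCommGroup E] [Module ℝ E] [Norm E] [MetricSpace E] :
    Prop where
  r_pos : 0 < r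
  r_le_one : r ≤ 1
  norm_nonneg : ∀ x : E, 0 ≤ ‖x‖
  norm_smul : ∀ (c : ℝ) (x : E), ‖c • x‖ = |c| * ‖x‖
  norm_eq_zero_iff : ∀ x : E, ‖x‖ = 0 ↔ x = 0
  norm_add_rpow_le : ∀ x y : E, ‖x + y‖ ^ r ≤ ‖x‖ ^ r + ‖y‖ ^ r
  dist_eq : ∀ x y : E, dist x y = ‖x - y‖ ^ r

/-- A Gaussian sequence: independent centered standard Gaussian real random variables. -/
structure IsGaussianSequence {Ω : Type*} [MeasurableSpace Ω] (γ : ℕ → Ω → ℝ) (P : Measure Ω) :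
    Prop where
  measurable : ∀ n, Measurable (γ n)
  map_eq : ∀ n, P.map (γ n) = gaussianReal 0 1
  indep : iIndepFun γ P

section Lp

variable {Ω E : Type*} [MeasurableSpace Ω]

/-- The `L^p(Ω; E)`-(quasi-)norm `(𝔼 ‖f‖ ^ p) ^ (1 / p)`, with values in `[0, ∞]`. -/
noncomputable def lpQuasiNorm [Norm E] (p : ℝ) (P : Measure Ω) (f : Ω → E) : ℝ≥0∞ :=
  (∫⁻ ω, ENNReal.ofReal ‖f ω‖ ^ p ∂P) ^ (1 / p)

/-- The sequence `X` converges to `S` in `L^p(Ω; E)`; this includes `S ∈ L^p(Ω; E)`. -/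
def LpConvergesTo [AddCommGroup E] [Norm E] [TopologicalSpace E] (p : ℝ) (P : Measure Ω)
    (X : ℕ → Ω → E) (S : Ω → E) : Prop :=
  AEStronglyMeasurable S P ∧ lpQuasiNorm p P S < ∞ ∧
    Tendsto (fun N => lpQuasiNorm p P (fun ω => X N ω - S ω)) atTop (𝓝 0)

/-- The sequence `X` converges in `L^p(Ω; E)`. -/
def LpConverges [AddCommGroup E] [Norm E] [TopologicalSpace E] (p : ℝ) (P : Measure Ω)
    (X : ℕ → Ω → E) : Prop :=
  ∃ S : Ω → E, LpConvergesTo p P X S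

end Lp

section Gamma

variable {Ω H E : Type*} [MeasurableSpace Ω] [NormedAddCommGroup H] [InnerProductSpace ℝ H]
  [AddCommGroup E] [Module ℝ E]

/-- The partial sum of the first `N` terms of the Gaussian series `∑ γₙ xₙ`. -/
def gaussianSum (γ : ℕ → Ω → ℝ) (x : ℕ → E) (N : ℕ) (ω : Ω) : E :=
  ∑ n ∈ Finset.range N, γ n ω • x n

/-- `‖R‖_{γ_∞^p(H,E)}`: the supremum over all finite orthonormal systems `u` in `H` of the
`L^p`-norm of the Gaussian sum `∑ γₙ R uₙ`. -/
noncomputable def gammaNorm [Norm E] (γ : ℕ → Ω → ℝ) (P : Measure Ω) (p : ℝ) (R : H →ₗ[ℝ] E) :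
    ℝ≥0∞ :=
  ⨆ (N : ℕ) (u : Fin N → H) (_ : Orthonormal ℝ u),
    lpQuasiNorm p P (fun ω => ∑ n : Fin N, γ n ω • R (u n))

/-- `γ_∞(H,E)`, the set of `γ`-summing operators. -/
def gammaSumming (H E : Type*) [NormedAddCommGroup H] [InnerProductSpace ℝ H]
    [AddCommGroup E] [Module ℝ E] [Norm E] (γ : ℕ → Ω → ℝ) (P : Measure Ω) :
    Set (H →ₗ[ℝ] E) :=
  {R | gammaNorm γ P 2 R < ∞}

/-- The rank one operator `h ⊗ x : g ↦ ⟨g, h⟩ x`. -/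
noncomputable def rankOne (h : H) (x : E) : H →ₗ[ℝ] E :=
  (innerSL ℝ h).toLinearMap.smulRight x

/-- The space `H ⊗ E` of (bounded) finite rank operators. -/
def finiteRank (H E : Type*) [NormedAddCommGroup H] [InnerProductSpace ℝ H]
    [AddCommGroup E] [Module ℝ E] : Submodule ℝ (H →ₗ[ℝ] E) :=
  Submodule.span ℝ {T | ∃ (h : H) (x : E), T = rankOne h x}

/-- `γ(H,E)`, the set of `γ`-radonifying operators: the closure of the finite rank operators in
`γ_∞(H,E)` with respect to `‖·‖_{γ_∞(H,E)}`. -/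
def gammaRadonifying (H E : Type*) [NormedAddCommGroup H] [InnerProductSpace ℝ H]
    [AddCommGroup E] [Module ℝ E] [Norm E] (γ : ℕ → Ω → ℝ) (P : Measure Ω) :
    Set (H →ₗ[ℝ] E) :=
  {R | R ∈ gammaSumming H E γ P ∧
    ∀ ε : ℝ, 0 < ε → ∃ T ∈ finiteRank H E, gammaNorm γ P 2 (R - T) < ENNReal.ofReal ε}

end Gamma

/-- The constant `2 ^ ((1 - r ∧ p) / (r ∧ p))`. -/
noncomputable def gammaConst (r p : ℝ) : ℝ≥0∞ :=
  ENNReal.ofReal ((2 : ℝ) ^ ((1 - min r p) / min r p))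

end GammaRad

/-! The heart is a domination principle. If the covariance of a finite Gaussian sum X is at most
that of Y, the missing covariance is carried by an independent Gaussian sum Z. Then X + Z and X - Z
both have the law of Y, and X is half their sum. The triangle inequality for s-th powers in L^p, s =
r ∧ p, bounds ‖X‖ by 2^((1-s)/s) ‖Y‖. Since E may have too few functionals, laws are compared in a
Hilbert space by characteristic functions and then pushed forward to E.

Projecting an orthonormal system onto the span of the first M basis vectors gives a covariance
dominated by theirs. Fatou's lemma as M → ∞ then yields both upper bounds
(`IsGaussianSequence.gammaNorm_le_of_tendsto`). The lower bounds hold because the basis vectors are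
themselves orthonormal systems, with Fatou once more for the full series.

Independence of p is the Kahane–Khintchine inequality (`IsGaussianSequence.exists_lpQuasiNorm_le`),
proved by Fernique's rotation trick; almost sure convergence comes from Lévy's maximal inequality.
In (ii), the Gaussian series of a finite rank operator is Cauchy, and this property survives the
closure. Conversely, if the series of R is Cauchy, restricting R to the first M basis vectors gives
finite rank approximants, whose error is a tail of the series by domination. -/

namespace GammaRad

/-! ### The topology of an r-normed space -/

section RNormedSpace

variable (r : ℝ) {E : Type*} [AddCommGroup E] [Module ℝ E] [Norm E] [MetricSpace E]
  [IsRNormedSpace r E]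

namespace IsRNormedSpace

include r

theorem norm_neg (x : E) : ‖-x‖ = ‖x‖ := by
  simpa using IsRNormedSpace.norm_smul r (-1) x

theorem norm_rpow_le_add_dist (x y : E) : ‖x‖ ^ r ≤ ‖y‖ ^ r + dist x y := by
  have h := norm_add_rpow_le (r := r) y (x - y)
  rwa [add_sub_cancel, ← dist_eq (r := r)] at h

theorem continuous_norm_rpow : Continuous fun x : E => ‖x‖ ^ r := by
  refine (LipschitzWith.of_dist_le_mul (K := 1) fun x y => ?_).continuous
  rw [Real.dist_eq, abs_sub_le_iff, NNReal.coe_one, one_mul]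
  have h1 := norm_rpow_le_add_dist r x y
  have h2 := norm_rpow_le_add_dist r y x
  rw [dist_comm y x] at h2
  constructor <;> linarith

/-- Only the r-th power of the norm is Lipschitz for the metric; the norm is recovered from it by a
continuous power. -/
theorem continuous_norm : Continuous fun x : E => ‖x‖ := by
  have hr : 0 < r := r_pos E
  have h := (continuous_norm_rpow (E := E) r).rpow_const (p := 1 / r)
    fun _ => Or.inr (by positivity)
  refine h.congr fun x => ?_
  rw [one_div, Real.rpow_rpow_inv (IsRNormedSpace.norm_nonneg r x) hr.ne']

theorem isTopologicalAddGroup : IsTopologicalAddGroup E where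
  continuous_add := by
    refine (LipschitzWith.of_dist_le_mul (K := 2) fun x y => ?_).continuous
    rw [dist_eq (r := r), add_sub_add_comm]
    refine (norm_add_rpow_le _ _).trans ?_
    rw [← dist_eq (r := r), ← dist_eq (r := r), Prod.dist_eq]
    have h1 := le_max_left (dist x.1 y.1) (dist x.2 y.2)
    have h2 := le_max_right (dist x.1 y.1) (dist x.2 y.2)
    push_cast
    linarith
  continuous_neg := by
    refine (LipschitzWith.of_dist_le_mul (K := 1) fun x y => ?_).continuous
    rw [dist_eq (r := r), dist_eq (r := r), ← norm_neg r (x - y), neg_sub_neg, neg_sub]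
    simp

theorem continuousSMul : ContinuousSMul ℝ E := by
  have hr : 0 < r := r_pos E
  have hn : ∀ x : E, 0 ≤ ‖x‖ := IsRNormedSpace.norm_nonneg r
  refine ⟨continuous_iff_continuousAt.2 fun p => ?_⟩
  rw [ContinuousAt, tendsto_iff_dist_tendsto_zero]
  have hlim : Tendsto (fun q : ℝ × E => |q.1| ^ r * dist q.2 p.2 + |q.1 - p.1| ^ r * ‖p.2‖ ^ r)
      (𝓝 p) (𝓝 0) := by
    have hc : Continuous fun q : ℝ × E =>
        |q.1| ^ r * dist q.2 p.2 + |q.1 - p.1| ^ r * ‖p.2‖ ^ r := by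
      refine Continuous.add (Continuous.mul ?_ (by fun_prop)) (Continuous.mul ?_ (by fun_prop))
      · exact (by fun_prop : Continuous fun q : ℝ × E => |q.1|).rpow_const fun _ => Or.inr hr.le
      · exact (by fun_prop : Continuous fun q : ℝ × E => |q.1 - p.1|).rpow_const
          fun _ => Or.inr hr.le
    simpa [Real.zero_rpow hr.ne'] using hc.tendsto p
  refine squeeze_zero (fun _ => dist_nonneg) (fun q => ?_) hlim
  have hsplit : q.1 • q.2 - p.1 • p.2 = q.1 • (q.2 - p.2) + (q.1 - p.1) • p.2 := by
    rw [smul_sub, sub_smul]; abel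
  rw [dist_eq (r := r), hsplit]
  refine (norm_add_rpow_le _ _).trans_eq ?_
  rw [IsRNormedSpace.norm_smul r, IsRNormedSpace.norm_smul r,
    Real.mul_rpow (abs_nonneg _) (hn _), Real.mul_rpow (abs_nonneg _) (hn _),
    ← dist_eq (r := r)]

end IsRNormedSpace

end RNormedSpace

/-! ### The quasi-norm of L^p(Ω; E) -/

section LpQuasiNorm

variable {Ω : Type*} [MeasurableSpace Ω] {P : Measure Ω}

section Norm

variable {E : Type*} [Norm E] {p : ℝ}

theorem lpQuasiNorm_rpow (hp : 0 < p) (f : Ω → E) :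
    lpQuasiNorm p P f ^ p = ∫⁻ ω, ENNReal.ofReal ‖f ω‖ ^ p ∂P := by
  rw [lpQuasiNorm, ← ENNReal.rpow_mul, one_div_mul_cancel hp.ne', ENNReal.rpow_one]

theorem lpQuasiNorm_le_iff (hp : 0 < p) (f : Ω → E) (c : ℝ≥0∞) :
    lpQuasiNorm p P f ≤ c ↔ ∫⁻ ω, ENNReal.ofReal ‖f ω‖ ^ p ∂P ≤ c ^ p := by
  rw [← lpQuasiNorm_rpow hp, ENNReal.rpow_le_rpow_iff hp]

theorem lpQuasiNorm_congr {E' : Type*} [Norm E'] {f : Ω → E} {g : Ω → E'}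
    (h : ∀ ω, ‖f ω‖ = ‖g ω‖) : lpQuasiNorm p P f = lpQuasiNorm p P g := by
  simp [lpQuasiNorm, h]

theorem lpQuasiNorm_eq_of_map_eq {X : Type*} [MeasurableSpace X] {F : X → E}
    (hF : Measurable fun x => ‖F x‖) {f g : Ω → X} (hf : AEMeasurable f P) (hg : AEMeasurable g P)
    (h : P.map f = P.map g) :
    lpQuasiNorm p P (fun ω => F (f ω)) = lpQuasiNorm p P (fun ω => F (g ω)) := by
  have hm : Measurable fun x => ENNReal.ofReal ‖F x‖ ^ p := by fun_prop
  rw [lpQuasiNorm, lpQuasiNorm, ← lintegral_map' hm.aemeasurable hf,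
    ← lintegral_map' hm.aemeasurable hg, h]

/-- Fatou's lemma for the `L^p`-quasi-norm. -/
theorem lpQuasiNorm_le_of_tendsto [TopologicalSpace E] [MeasurableSpace E]
    (hc : Continuous fun x : E => ‖x‖) (hn : Measurable fun x : E => ‖x‖) (hp : 0 < p)
    {f : ℕ → Ω → E} {g : Ω → E} (hf : ∀ n, AEMeasurable (f n) P)
    (hlim : ∀ᵐ ω ∂P, Tendsto (fun n => f n ω) atTop (𝓝 (g ω))) {c : ℕ → ℝ≥0∞} {C : ℝ≥0∞}
    (hle : ∀ᶠ n in atTop, lpQuasiNorm p P (f n) ≤ c n) (hC : Tendsto c atTop (𝓝 C)) :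
    lpQuasiNorm p P g ≤ C := by
  rw [lpQuasiNorm_le_iff hp]
  have hmeas : Measurable fun x : E => ENNReal.ofReal ‖x‖ ^ p := by fun_prop
  have hcont : Continuous fun x : E => ENNReal.ofReal ‖x‖ ^ p :=
    ENNReal.continuous_rpow_const.comp (ENNReal.continuous_ofReal.comp hc)
  calc ∫⁻ ω, ENNReal.ofReal ‖g ω‖ ^ p ∂P
      = ∫⁻ ω, liminf (fun n => ENNReal.ofReal ‖f n ω‖ ^ p) atTop ∂P := by
        refine lintegral_congr_ae ?_
        filter_upwards [hlim] with ω hω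
        exact ((hcont.tendsto _).comp hω).liminf_eq.symm
    _ ≤ liminf (fun n => ∫⁻ ω, ENNReal.ofReal ‖f n ω‖ ^ p ∂P) atTop :=
        lintegral_liminf_le' fun n => hmeas.comp_aemeasurable (hf n)
    _ ≤ liminf (fun n => c n ^ p) atTop := by
        refine liminf_le_liminf ?_
        filter_upwards [hle] with n h
        rwa [← lpQuasiNorm_le_iff hp]
    _ = C ^ p := ((ENNReal.continuous_rpow_const.tendsto _).comp hC).liminf_eq

/-- Markov's inequality for the `L^p`-quasi-norm. -/
theorem measure_lt_norm_le [MeasurableSpace E] (hn : Measurable fun x : E => ‖x‖) (hp : 0 < p)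
    {f : Ω → E} (hf : AEMeasurable f P) {a : ℝ} (ha : 0 < a) :
    P {ω | a < ‖f ω‖} ≤ (lpQuasiNorm p P f / ENNReal.ofReal a) ^ p := by
  have hmeas : Measurable fun x : E => ENNReal.ofReal ‖x‖ ^ p := by fun_prop
  rw [ENNReal.div_rpow_of_nonneg _ _ hp.le, lpQuasiNorm_rpow hp,
    ENNReal.le_div_iff_mul_le (by simp [ha]) (by simp [hp.le]), mul_comm]
  refine le_trans ?_ (mul_meas_ge_le_lintegral₀ (hmeas.comp_aemeasurable hf)
    (ENNReal.ofReal a ^ p))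
  gcongr with ω
  intro hω
  exact ENNReal.rpow_le_rpow (ENNReal.ofReal_le_ofReal (le_of_lt hω)) hp.le

end Norm

section RNorm

variable (r : ℝ) {E : Type*} [AddCommGroup E] [Module ℝ E] [Norm E] [MetricSpace E]
  [IsRNormedSpace r E] {p : ℝ}

include r

theorem lpQuasiNorm_neg (f : Ω → E) :
    lpQuasiNorm p P (fun ω => -f ω) = lpQuasiNorm p P f :=
  lpQuasiNorm_congr fun ω => IsRNormedSpace.norm_neg r (f ω)

theorem lpQuasiNorm_sub_comm (f g : Ω → E) :
    lpQuasiNorm p P (fun ω => f ω - g ω) = lpQuasiNorm p P (fun ω => g ω - f ω) := by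
  rw [← lpQuasiNorm_neg r]
  simp

theorem lpQuasiNorm_zero (hp : 0 < p) : lpQuasiNorm p P (fun _ => (0 : E)) = 0 := by
  simp [lpQuasiNorm, (IsRNormedSpace.norm_eq_zero_iff r (0 : E)).2 rfl, hp]

theorem lpQuasiNorm_const_smul (hp : 0 < p) (c : ℝ) (f : Ω → E) :
    lpQuasiNorm p P (fun ω => c • f ω) = ENNReal.ofReal |c| * lpQuasiNorm p P f := by
  refine (ENNReal.rpow_left_injective hp.ne') ?_
  simp only
  rw [ENNReal.mul_rpow_of_nonneg _ _ hp.le, lpQuasiNorm_rpow hp, lpQuasiNorm_rpow hp,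
    ← lintegral_const_mul' _ _ (by simp [hp.le])]
  refine lintegral_congr fun ω => ?_
  rw [IsRNormedSpace.norm_smul r, ENNReal.ofReal_mul (abs_nonneg c),
    ENNReal.mul_rpow_of_nonneg _ _ hp.le]

/-- The quasi-triangle inequality in `L^p(Ω; E)`. -/
theorem lpQuasiNorm_add_rpow_le [MeasurableSpace E] [OpensMeasurableSpace E] (hp : 0 < p)
    {f g : Ω → E} (hf : AEMeasurable f P) (hg : AEMeasurable g P) :
    lpQuasiNorm p P (fun ω => f ω + g ω) ^ min r p ≤
      lpQuasiNorm p P f ^ min r p + lpQuasiNorm p P g ^ min r p := by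
  have hr : 0 < r := IsRNormedSpace.r_pos E
  have hn : Measurable fun x : E => ‖x‖ := (IsRNormedSpace.continuous_norm r).measurable
  have hnn : ∀ x : E, 0 ≤ ‖x‖ := IsRNormedSpace.norm_nonneg r
  have hadd : ∀ x y : E, ENNReal.ofReal ‖x + y‖ ^ r ≤
      ENNReal.ofReal ‖x‖ ^ r + ENNReal.ofReal ‖y‖ ^ r := fun x y => by
    rw [ENNReal.ofReal_rpow_of_nonneg (hnn _) hr.le, ENNReal.ofReal_rpow_of_nonneg (hnn _) hr.le,
      ENNReal.ofReal_rpow_of_nonneg (hnn _) hr.le,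
      ← ENNReal.ofReal_add (Real.rpow_nonneg (hnn _) _) (Real.rpow_nonneg (hnn _) _)]
    exact ENNReal.ofReal_le_ofReal (IsRNormedSpace.norm_add_rpow_le x y)
  have hm : ∀ {f : Ω → E}, AEMeasurable f P → ∀ s : ℝ,
      AEMeasurable (fun ω => ENNReal.ofReal ‖f ω‖ ^ s) P := fun hf s =>
    (by fun_prop : Measurable fun x : E => ENNReal.ofReal ‖x‖ ^ s).comp_aemeasurable hf
  -- The r-th power of the norm is subadditive. For r ≤ p this leaves Minkowski's inequality in the
  -- scalar L^(p/r); for p ≤ r the function t ↦ t^(p/r) is itself subadditive and one integrates.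
  rcases le_total r p with h | h
  · rw [min_eq_left h]
    have hpr : 1 ≤ p / r := (one_le_div hr).2 h
    have key : ∀ f : Ω → E, lpQuasiNorm p P f ^ r =
        (∫⁻ ω, (ENNReal.ofReal ‖f ω‖ ^ r) ^ (p / r) ∂P) ^ (1 / (p / r)) := fun f => by
      simp_rw [← ENNReal.rpow_mul]
      rw [lpQuasiNorm, ← ENNReal.rpow_mul, mul_div_cancel₀ _ hr.ne', one_div_div, one_div_mul_eq_div]
    rw [key, key, key]
    refine le_trans ?_ (ENNReal.lintegral_Lp_add_le (hm hf r) (hm hg r) hpr)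
    gcongr with ω
    exact hadd _ _
  · rw [min_eq_right h, lpQuasiNorm_rpow hp, lpQuasiNorm_rpow hp, lpQuasiNorm_rpow hp,
      ← lintegral_add_left' (hm hf p)]
    refine lintegral_mono fun ω => ?_
    have hpr : p / r ≤ 1 := (div_le_one hr).2 h
    have hpr0 : 0 ≤ p / r := by positivity
    have e : ∀ t : ℝ≥0∞, t ^ p = (t ^ r) ^ (p / r) := fun t => by
      rw [← ENNReal.rpow_mul, mul_div_cancel₀ _ hr.ne']
    simp only [e]
    exact (ENNReal.rpow_le_rpow (hadd _ _) hpr0).trans (ENNReal.rpow_add_le_add_rpow _ _ hpr0 hpr)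

omit [IsRNormedSpace r E] in
-- The origin of the constant: with s = r ∧ p, averaging two functions of size t costs ½ (2
-- t^s)^(1/s) = 2^(1/s - 1) t.
theorem gammaConst_mul_eq (hr : 0 < r) (hp : 0 < p) (t : ℝ≥0∞) :
    gammaConst r p * t = ENNReal.ofReal (1 / 2) * (t ^ min r p + t ^ min r p) ^ (1 / min r p) := by
  have hs : 0 < min r p := lt_min hr hp
  rw [← two_mul, ENNReal.mul_rpow_of_nonneg _ _ (by positivity), ← ENNReal.rpow_mul,
    mul_one_div_cancel hs.ne', ENNReal.rpow_one, ← mul_assoc, gammaConst, sub_div,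
    div_self hs.ne', Real.rpow_sub two_pos, Real.rpow_one, ← ENNReal.ofReal_ofNat,
    ENNReal.ofReal_rpow_of_pos two_pos, ← ENNReal.ofReal_mul (by norm_num)]
  congr 2
  ring

theorem lpQuasiNorm_half_add_le [MeasurableSpace E] [OpensMeasurableSpace E] (hp : 0 < p)
    {f g : Ω → E} (hf : AEMeasurable f P) (hg : AEMeasurable g P) {t : ℝ≥0∞}
    (hft : lpQuasiNorm p P f ≤ t) (hgt : lpQuasiNorm p P g ≤ t) :
    lpQuasiNorm p P (fun ω => (1 / 2 : ℝ) • (f ω + g ω)) ≤ gammaConst r p * t := by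
  have hr : 0 < r := IsRNormedSpace.r_pos E
  have hs : 0 < min r p := lt_min hr hp
  rw [lpQuasiNorm_const_smul r hp, gammaConst_mul_eq r hr hp, abs_of_pos one_half_pos]
  gcongr
  rw [one_div, ENNReal.le_rpow_inv_iff hs]
  refine (lpQuasiNorm_add_rpow_le r hp hf hg).trans ?_
  gcongr

theorem lpQuasiNorm_add_lt_top [MeasurableSpace E] [OpensMeasurableSpace E] (hp : 0 < p)
    {f g : Ω → E} (hf : AEMeasurable f P) (hg : AEMeasurable g P)
    (hft : lpQuasiNorm p P f < ∞) (hgt : lpQuasiNorm p P g < ∞) :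
    lpQuasiNorm p P (fun ω => f ω + g ω) < ∞ := by
  have hs : 0 < min r p := lt_min (IsRNormedSpace.r_pos E) hp
  rw [← ENNReal.rpow_lt_top_iff_of_pos hs] at hft hgt ⊢
  exact (lpQuasiNorm_add_rpow_le r hp hf hg).trans_lt (ENNReal.add_lt_top.2 ⟨hft, hgt⟩)

/-- If two functions are small in `L^p(Ω; E)`, so is their sum. -/
theorem exists_lpQuasiNorm_add_le (E) [AddCommGroup E] [Module ℝ E] [Norm E] [MetricSpace E]
    [IsRNormedSpace r E] [MeasurableSpace E] [OpensMeasurableSpace E]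
    (hp : 0 < p) {ε : ℝ≥0∞} (hε : 0 < ε) :
    ∃ δ : ℝ≥0∞, 0 < δ ∧ ∀ f g : Ω → E, AEMeasurable f P → AEMeasurable g P →
      lpQuasiNorm p P f ≤ δ → lpQuasiNorm p P g ≤ δ →
      lpQuasiNorm p P (fun ω => f ω + g ω) ≤ ε := by
  have hs : 0 < min r p := lt_min (IsRNormedSpace.r_pos E) hp
  refine ⟨(ε ^ min r p / 2) ^ (1 / min r p), ENNReal.rpow_pos_of_nonneg
    (ENNReal.half_pos (ENNReal.rpow_pos_of_nonneg hε hs.le).ne') (by positivity), fun f g hf hg hfd hgd => ?_⟩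
  rw [one_div, ENNReal.le_rpow_inv_iff hs] at hfd hgd
  rw [← ENNReal.rpow_le_rpow_iff hs]
  refine (lpQuasiNorm_add_rpow_le r hp hf hg).trans ((add_le_add hfd hgd).trans_eq ?_)
  exact ENNReal.add_halves _

end RNorm

end LpQuasiNorm

open scoped RealInnerProductSpace

/-! ### Laws of Gaussian sums in Hilbert spaces -/

section GaussianFamily

variable {Ω Ω' : Type*} [MeasurableSpace Ω] [MeasurableSpace Ω'] {P : Measure Ω} {P' : Measure Ω'}

/-- A family of independent standard Gaussian random variables. -/
structure IsGaussianFamily {ι : Type*} (g : ι → Ω → ℝ) (P : Measure Ω) : Prop where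
  measurable : ∀ i, Measurable (g i)
  map_eq : ∀ i, P.map (g i) = gaussianReal 0 1
  indep : iIndepFun g P

theorem IsGaussianSequence.isGaussianFamily_comp {γ : ℕ → Ω → ℝ} (hγ : IsGaussianSequence γ P)
    {ι : Type*} {e : ι → ℕ} (he : e.Injective) : IsGaussianFamily (fun i => γ (e i)) P :=
  ⟨fun _ => hγ.measurable _, fun _ => hγ.map_eq _, hγ.indep.precomp he⟩

/-- Changing the signs of some of its members turns a Gaussian sequence into another one. -/
theorem IsGaussianSequence.ite_neg {γ : ℕ → Ω → ℝ} (hγ : IsGaussianSequence γ P) (k : ℕ) :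
    IsGaussianSequence (fun i ω => if i < k then γ i ω else -γ i ω) P where
  measurable := fun i => by
    have := hγ.measurable i
    split_ifs <;> fun_prop
  map_eq := fun i => by
    split_ifs
    · exact hγ.map_eq i
    · have h := Measure.map_map (μ := P) measurable_neg (hγ.measurable i)
      rw [hγ.map_eq i] at h
      have h' : Measure.map (fun ω => -γ i ω) P = gaussianReal (-0) 1 := by
        rw [← gaussianReal_map_neg]; exact h.symm
      rwa [neg_zero] at h'
  indep := by
    have h := hγ.indep.comp (fun i x => if i < k then x else -x) fun i => by
      split_ifs <;> fun_prop
    exact h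

/-- All Gaussian sequences have the same law. -/
theorem IsGaussianSequence.map_eq_map {γ : ℕ → Ω → ℝ} {γ' : ℕ → Ω' → ℝ}
    (hγ : IsGaussianSequence γ P) (hγ' : IsGaussianSequence γ' P') :
    P.map (fun ω i => γ i ω) = P'.map (fun ω i => γ' i ω) := by
  rw [hγ.indep.map_fun_eq_infinitePi_map hγ.measurable,
    hγ'.indep.map_fun_eq_infinitePi_map hγ'.measurable]
  simp_rw [hγ.map_eq, hγ'.map_eq]

variable {ι κ V : Type*} [Fintype ι] [Fintype κ]

theorem IsGaussianFamily.map_fun_eq_pi {g : ι → Ω → ℝ} (hg : IsGaussianFamily g P) :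
    P.map (fun ω i => g i ω) = Measure.pi fun _ => gaussianReal 0 1 := by
  have := hg.indep.map_fun_eq_pi_map fun i => (hg.measurable i).aemeasurable
  simpa [hg.map_eq] using this

variable [NormedAddCommGroup V] [InnerProductSpace ℝ V]

theorem IsGaussianFamily.measurable_sum_smul {W : Type*} [AddCommMonoid W] [Module ℝ W]
    [TopologicalSpace W] [ContinuousAdd W] [ContinuousSMul ℝ W] [MeasurableSpace W] [BorelSpace W]
    [SecondCountableTopology W] {g : ι → Ω → ℝ} (hg : IsGaussianFamily g P) (v : ι → W) :
    Measurable fun ω => ∑ i, g i ω • v i := by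
  have := hg.measurable
  fun_prop

variable [MeasurableSpace V] [BorelSpace V] [SecondCountableTopology V]

/-- By independence the characteristic function factors, and each factor is that of a standard
Gaussian at ⟪v i, t⟫. Only the quadratic form of the covariance survives. -/
theorem IsGaussianFamily.charFun_map_sum_smul {g : ι → Ω → ℝ} (hg : IsGaussianFamily g P)
    (v : ι → V) (t : V) :
    charFun (P.map fun ω => ∑ i, g i ω • v i) t = Complex.exp (-((∑ i, ⟪v i, t⟫ ^ 2 : ℝ) / 2)) := by
  have hm := hg.measurable
  have hind : iIndepFun (fun i ω => g i ω • v i) P :=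
    hg.indep.comp (fun i x => x • v i) fun i => by fun_prop
  rw [hind.charFun_map_fun_sum_eq_prod fun i => by fun_prop, Finset.prod_apply]
  have h1 : ∀ i, charFun (P.map fun ω => g i ω • v i) t =
      Complex.exp (-((⟪v i, t⟫ ^ 2 : ℝ) / 2)) := fun i => by
    have h2 := charFun_gaussianReal (μ := 0) (v := 1) ⟪v i, t⟫
    rw [← hg.map_eq i, charFun_apply, integral_map (by fun_prop) (by fun_prop)] at h2
    rw [charFun_apply, integral_map (by fun_prop) (by fun_prop)]
    convert h2 using 1
    · refine integral_congr_ae (Eventually.of_forall fun ω => ?_)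
      simp [real_inner_smul_left, mul_comm]
    · congr 1
      push_cast
      ring
  rw [Finset.prod_congr rfl fun i _ => h1 i, ← Complex.exp_sum]
  congr 1
  push_cast
  rw [Finset.sum_neg_distrib, Finset.sum_div]

/-- The law of a Gaussian sum is determined by its covariance. -/
theorem IsGaussianFamily.map_sum_smul_eq [CompleteSpace V] [IsFiniteMeasure P] [IsFiniteMeasure P']
    {g : ι → Ω → ℝ} {g' : κ → Ω' → ℝ} (hg : IsGaussianFamily g P) (hg' : IsGaussianFamily g' P')
    {v : ι → V} {w : κ → V} (h : ∀ t, ∑ i, ⟪v i, t⟫ ^ 2 = ∑ k, ⟪w k, t⟫ ^ 2) :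
    P.map (fun ω => ∑ i, g i ω • v i) = P'.map (fun ω => ∑ k, g' k ω • w k) := by
  refine Measure.ext_of_charFun (funext fun t => ?_)
  rw [hg.charFun_map_sum_smul, hg'.charFun_map_sum_smul, h]

end GaussianFamily

/-! ### Covariance domination -/

section Domination

variable {H : Type*} [NormedAddCommGroup H] [InnerProductSpace ℝ H]

/-- Pythagoras: this is the defect in Bessel's inequality, which becomes the missing covariance
below. -/
theorem norm_sub_sum_inner_smul_sq {ι : Type*} [Fintype ι] {u : ι → H} (hu : Orthonormal ℝ u)
    (y : H) : ‖y - ∑ i, ⟪u i, y⟫ • u i‖ ^ 2 = ‖y‖ ^ 2 - ∑ i, ⟪u i, y⟫ ^ 2 := by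
  have h1 : ⟪y, ∑ i, ⟪u i, y⟫ • u i⟫ = ∑ i, ⟪u i, y⟫ ^ 2 := by
    simp [inner_sum, real_inner_smul_right, real_inner_comm y, sq]
  have h2 : ‖∑ i, ⟪u i, y⟫ • u i‖ ^ 2 = ∑ i, ⟪u i, y⟫ ^ 2 := by
    rw [← real_inner_self_eq_norm_sq, hu.inner_sum]
    simp [sq]
  rw [norm_sub_sq_real, h1, h2]
  ring

/-- The truncations `∑ₖ ⟪bₖ, uᵢ⟫ bₖ` of an orthonormal system `u` can be completed to a system
with the same covariance as the orthonormal system `b`. -/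
theorem exists_complement_covariance {ι κ : Type*} [Fintype ι] [Fintype κ] {u : ι → H} {b : κ → H}
    (hu : Orthonormal ℝ u) (hb : Orthonormal ℝ b) :
    ∃ (d : ℕ) (z : Fin d → H), ∀ t,
      ∑ i, ⟪∑ k, ⟪b k, u i⟫ • b k, t⟫ ^ 2 + ∑ j, ⟪z j, t⟫ ^ 2 = ∑ k, ⟪b k, t⟫ ^ 2 := by
  let Q : H →ₗ[ℝ] H := ∑ k, (innerₗ H (b k)).smulRight (b k)
  let U : H →ₗ[ℝ] H := ∑ i, (innerₗ H (u i)).smulRight (u i)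
  have hQ : ∀ x, Q x = ∑ k, ⟪b k, x⟫ • b k := fun x => by simp [Q]
  have hU : ∀ x, U x = ∑ i, ⟪u i, x⟫ • u i := fun x => by simp [U]
  have hsymm : ∀ x t, ⟪Q x, t⟫ = ⟪x, Q t⟫ := fun x t => by
    simp [hQ, inner_sum, sum_inner, real_inner_smul_left, real_inner_smul_right, real_inner_comm x,
      mul_comm]
  -- Q and U are the orthogonal projections onto the spans of b and u. The covariance to be supplied
  -- is ‖Q t‖² - ∑ ⟪u i, Q t⟫², which is ‖A t‖² for A = (1 - U) Q.
  let A : H →ₗ[ℝ] H := Q - U ∘ₗ Q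
  have hfin : FiniteDimensional ℝ A.range := by
    have h1 : FiniteDimensional ℝ Q.range := by
      have := FiniteDimensional.span_of_finite ℝ (Set.finite_range b)
      refine Submodule.finiteDimensional_of_le (S₂ := Submodule.span ℝ (Set.range b)) ?_
      rintro _ ⟨x, rfl⟩
      rw [hQ]
      exact Submodule.sum_mem _ fun k _ =>
        Submodule.smul_mem _ _ (Submodule.subset_span ⟨k, rfl⟩)
    have h2 : A = (LinearMap.id - U) ∘ₗ Q := by ext; simp [A]
    rw [h2, LinearMap.range_comp]
    infer_instance
  let w := stdOrthonormalBasis ℝ A.range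
  -- Since w j lies in the range of A, it is orthogonal to every u i, so ⟪Q (w j), t⟫ = ⟪w j, Q t⟫ =
  -- ⟪w j, A t⟫. Parseval in the range of A then gives ‖A t‖².
  refine ⟨_, fun j => Q (w j : H), fun t => ?_⟩
  have horth : ∀ y i, ⟪(A y : H), u i⟫ = 0 := fun y i => by
    simp only [A, LinearMap.sub_apply, LinearMap.comp_apply, inner_sub_left, hU]
    rw [hu.inner_left_fintype, real_inner_comm, conj_trivial, sub_self]
  have h3 : ∀ j, ⟪Q (w j : H), t⟫ = ⟪w j, (⟨A t, LinearMap.mem_range_self A t⟩ : A.range)⟫ := by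
    intro j
    obtain ⟨y, hy⟩ := (w j).2
    have h4 : Q t = A t + ∑ i, ⟪u i, Q t⟫ • u i := by simp [A, hU]
    rw [hsymm, Submodule.coe_inner, h4, inner_add_right, inner_sum]
    simp [real_inner_smul_right, ← hy, horth]
  have h5 : ∑ j, ⟪Q (w j : H), t⟫ ^ 2 = ‖A t‖ ^ 2 := by
    simp_rw [h3]
    have h6 := w.sum_sq_norm_inner_right (⟨A t, LinearMap.mem_range_self A t⟩ : A.range)
    simpa using h6
  have h7 : ‖A t‖ ^ 2 = ‖Q t‖ ^ 2 - ∑ i, ⟪u i, Q t⟫ ^ 2 := by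
    rw [← norm_sub_sum_inner_smul_sq hu, ← hU]
    rfl
  have h8 : ‖Q t‖ ^ 2 = ∑ k, ⟪b k, t⟫ ^ 2 := by
    rw [hQ, ← real_inner_self_eq_norm_sq, hb.inner_sum]
    simp [sq]
  simp_rw [← hQ]
  rw [h5, h7, h8]
  simp_rw [hsymm]
  ring

variable {Ω : Type*} [MeasurableSpace Ω] {P : Measure Ω} (r : ℝ)
  {E : Type*} [AddCommGroup E] [Module ℝ E] [Norm E] [MetricSpace E] [IsRNormedSpace r E]

include r in
/-- Two Gaussian sums with the same covariance have the same `L^p`-quasi-norm. -/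
theorem lpQuasiNorm_sum_eq_of_covariance [IsFiniteMeasure P] {V ι κ : Type*} [Fintype ι] [Fintype κ]
    [NormedAddCommGroup V] [InnerProductSpace ℝ V] [CompleteSpace V] [SecondCountableTopology V]
    {g : ι → Ω → ℝ} {g' : κ → Ω → ℝ} (hg : IsGaussianFamily g P) (hg' : IsGaussianFamily g' P)
    {v : ι → V} {w : κ → V} (h : ∀ t, ∑ i, ⟪v i, t⟫ ^ 2 = ∑ k, ⟪w k, t⟫ ^ 2) (p : ℝ)
    (T : V →L[ℝ] E) :
    lpQuasiNorm p P (fun ω => ∑ i, g i ω • T (v i)) =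
      lpQuasiNorm p P (fun ω => ∑ k, g' k ω • T (w k)) := by
  borelize V
  have hn : Measurable fun x : V => ‖T x‖ :=
    ((IsRNormedSpace.continuous_norm r).comp T.continuous).measurable
  simpa using lpQuasiNorm_eq_of_map_eq (p := p) hn (hg.measurable_sum_smul v).aemeasurable
    (hg'.measurable_sum_smul w).aemeasurable (hg.map_sum_smul_eq hg' h)

variable [IsTopologicalAddGroup E] [ContinuousSMul ℝ E] [MeasurableSpace E] [BorelSpace E]

/-- A Gaussian sum whose covariance is dominated by that of another one. -/
theorem lpQuasiNorm_sum_le_of_covariance_add [IsFiniteMeasure P] [SecondCountableTopology E]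
    {V ι κ τ : Type*} [Fintype ι] [Fintype κ] [Fintype τ]
    [NormedAddCommGroup V] [InnerProductSpace ℝ V] [CompleteSpace V] [SecondCountableTopology V]
    {g : ι ⊕ κ → Ω → ℝ} {g' : τ → Ω → ℝ} (hg : IsGaussianFamily g P) (hg' : IsGaussianFamily g' P)
    {v : ι → V} {z : κ → V} {w : τ → V}
    (h : ∀ t, ∑ i, ⟪v i, t⟫ ^ 2 + ∑ j, ⟪z j, t⟫ ^ 2 = ∑ k, ⟪w k, t⟫ ^ 2) {p : ℝ} (hp : 0 < p)
    (T : V →L[ℝ] E) :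
    lpQuasiNorm p P (fun ω => ∑ i, g (.inl i) ω • T (v i)) ≤
      gammaConst r p * lpQuasiNorm p P (fun ω => ∑ k, g' k ω • T (w k)) := by
  -- Reversing the sign of z leaves the covariance unchanged, so both signed sums have the
  -- quasi-norm of the dominating sum, while z cancels in their average.
  have h1 := lpQuasiNorm_sum_eq_of_covariance r hg hg' (v := Sum.elim v z) (w := w)
    (fun t => by simpa using h t) p T
  have h2 := lpQuasiNorm_sum_eq_of_covariance r hg hg' (v := Sum.elim v (-z)) (w := w)
    (fun t => by simpa using h t) p T
  have h3 := lpQuasiNorm_half_add_le r hp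
    (hg.measurable_sum_smul fun i => T (Sum.elim v z i)).aemeasurable
    (hg.measurable_sum_smul fun i => T (Sum.elim v (-z) i)).aemeasurable h1.le h2.le
  refine le_trans (le_of_eq ?_) h3
  congr 1
  ext ω
  simp only [Fintype.sum_sum_type, Sum.elim_inl, Sum.elim_inr, Pi.neg_apply, map_neg, smul_neg,
    Finset.sum_neg_distrib]
  rw [add_add_add_comm, add_neg_cancel, add_zero, ← two_smul ℝ, smul_smul]
  norm_num

end Domination

/-! ### Fernique's argument and the Kahane–Khintchine inequality -/

section Kahane

variable {Ω : Type*} [MeasurableSpace Ω] {P : Measure Ω} [IsProbabilityMeasure P]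
  {γ : ℕ → Ω → ℝ}

/-- Rotating two independent copies of a Gaussian sum does not change their joint law. -/
theorem IsGaussianSequence.map_rotation {E : Type*} [AddCommGroup E] [Module ℝ E]
    [TopologicalSpace E] [IsTopologicalAddGroup E] [ContinuousSMul ℝ E] [MeasurableSpace E]
    [BorelSpace E] [SecondCountableTopology E] (hγ : IsGaussianSequence γ P) {n : ℕ}
    (x : Fin n → E) :
    P.map (fun ω => (∑ i : Fin n, γ i ω • x i, ∑ i : Fin n, γ (n + i) ω • x i)) =
      P.map (fun ω => ((√2)⁻¹ • (∑ i : Fin n, γ i ω • x i + ∑ i : Fin n, γ (n + i) ω • x i),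
        (√2)⁻¹ • (∑ i : Fin n, γ i ω • x i - ∑ i : Fin n, γ (n + i) ω • x i))) := by
  let e : Fin n ⊕ Fin n → ℕ := Sum.elim (fun i => i) fun i => n + i
  have he : e.Injective := by
    refine Function.Injective.sumElim (fun i j h => Fin.ext h)
      (fun i j h => Fin.ext (Nat.add_left_cancel h)) fun i j => ?_
    have := i.2
    lia
  have hg := hγ.isGaussianFamily_comp he
  -- The identity is proved for the coordinate vectors of ℝ^(2n): the system w obtained from b by
  -- mixing each pair at 45° is again orthonormal, hence has the same covariance. The linear map T
  -- carries it to E × E.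
  let b : Fin n ⊕ Fin n → EuclideanSpace ℝ (Fin n ⊕ Fin n) := fun j => EuclideanSpace.single j 1
  let w : Fin n ⊕ Fin n → EuclideanSpace ℝ (Fin n ⊕ Fin n) :=
    Sum.elim (fun i => (√2)⁻¹ • (b (.inl i) + b (.inr i)))
      fun i => (√2)⁻¹ • (b (.inl i) - b (.inr i))
  have hsq : (√2)⁻¹ ^ 2 = (1 / 2 : ℝ) := by
    rw [inv_pow, Real.sq_sqrt zero_le_two, one_div]
  have hcov : ∀ t, ∑ j, ⟪b j, t⟫ ^ 2 = ∑ j, ⟪w j, t⟫ ^ 2 := fun t => by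
    simp only [Fintype.sum_sum_type, w, Sum.elim_inl, Sum.elim_inr, real_inner_smul_left,
      inner_add_left, inner_sub_left, mul_pow, hsq]
    rw [← Finset.sum_add_distrib, ← Finset.sum_add_distrib]
    refine Finset.sum_congr rfl fun i _ => ?_
    ring
  let y : Fin n ⊕ Fin n → E × E := Sum.elim (fun i => (x i, 0)) fun i => (0, x i)
  let T : EuclideanSpace ℝ (Fin n ⊕ Fin n) →L[ℝ] E × E :=
    ∑ j, (EuclideanSpace.proj j).smulRight (y j)
  have hT : ∀ j, T (b j) = y j := fun j => by
    simp [T, b, PiLp.single_apply, -Fintype.sum_sum_type]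
  have key := congrArg (Measure.map T) (hg.map_sum_smul_eq hg hcov)
  rw [Measure.map_map T.continuous.measurable (hg.measurable_sum_smul _),
    Measure.map_map T.continuous.measurable (hg.measurable_sum_smul _)] at key
  convert key using 2
  · ext ω
    all_goals simp [hT, y, e, Prod.fst_sum, Prod.snd_sum]
  · ext ω
    all_goals simp [hT, y, w, e, Prod.fst_sum, Prod.snd_sum, smul_comm (_ : ℝ) (√2)⁻¹,
      ← Finset.smul_sum, sub_eq_add_neg]

variable (r : ℝ) {E : Type*} [AddCommGroup E] [Module ℝ E] [Norm E] [MetricSpace E]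
  [IsRNormedSpace r E]

/-- Used with y = (X + Y)/√2 and x either X or Y: then √2 x - y is ±(X - Y)/√2, so a small sum and a
large difference force both X and Y to be large. -/
theorem norm_rpow_sqrt_smul_sub_le (x y : E) :
    ‖√2 • x - y‖ ^ r ≤ 2 ^ (r / 2) * ‖x‖ ^ r + ‖y‖ ^ r := by
  have h := IsRNormedSpace.norm_add_rpow_le (r := r) (√2 • x) (-y)
  rw [IsRNormedSpace.norm_neg r, IsRNormedSpace.norm_smul r, abs_of_nonneg (Real.sqrt_nonneg _),
    Real.mul_rpow (Real.sqrt_nonneg _) (IsRNormedSpace.norm_nonneg r x), ← sub_eq_add_neg,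
    ← Real.rpow_div_two_eq_sqrt r zero_le_two] at h
  exact h

variable [IsTopologicalAddGroup E] [ContinuousSMul ℝ E] [MeasurableSpace E]
  [BorelSpace E] [SecondCountableTopology E]

/-- Fernique's inequality for the tails of a Gaussian sum. -/
theorem IsGaussianSequence.measure_mul_measure_le_sq (hγ : IsGaussianSequence γ P) {n : ℕ}
    (x : Fin n → E) {a b c : ℝ} (hb : 0 ≤ b) (hc : 0 ≤ c)
    (h : a ^ r + 2 ^ (r / 2) * c ^ r ≤ b ^ r) :
    P {ω | ‖∑ i : Fin n, γ i ω • x i‖ ≤ a} * P {ω | b < ‖∑ i : Fin n, γ i ω • x i‖} ≤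
      P {ω | c < ‖∑ i : Fin n, γ i ω • x i‖} ^ 2 := by
  have hr : 0 < r := IsRNormedSpace.r_pos E
  have hnn : ∀ x : E, 0 ≤ ‖x‖ := IsRNormedSpace.norm_nonneg r
  have hn : Measurable fun x : E => ‖x‖ := (IsRNormedSpace.continuous_norm r).measurable
  set X : Ω → E := fun ω => ∑ i : Fin n, γ i ω • x i
  set Y : Ω → E := fun ω => ∑ i : Fin n, γ (n + i) ω • x i
  have hgX : IsGaussianFamily (fun i : Fin n => γ i) P :=
    hγ.isGaussianFamily_comp fun i j h => Fin.ext h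
  have hgY : IsGaussianFamily (fun i : Fin n => γ (n + i)) P :=
    hγ.isGaussianFamily_comp fun i j h => Fin.ext (Nat.add_left_cancel h)
  have hX : Measurable X := hgX.measurable_sum_smul x
  have hY : Measurable Y := hgY.measurable_sum_smul x
  have hφ : Measurable fun z : Fin n → ℝ => ∑ i, z i • x i := by fun_prop
  have hlaw : P.map X = P.map Y := by
    have h1 := congrArg (Measure.map fun z : Fin n → ℝ => ∑ i, z i • x i)
      (hgX.map_fun_eq_pi.trans hgY.map_fun_eq_pi.symm)
    rwa [Measure.map_map hφ (measurable_pi_lambda _ hgX.measurable),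
      Measure.map_map hφ (measurable_pi_lambda _ hgY.measurable)] at h1
  have hind : IndepFun X Y P := by
    have h1 := hγ.indep.indepFun_finset (Finset.range n) (Finset.Ico n (n + n))
      (by rw [Finset.range_eq_Ico]; exact Finset.Ico_disjoint_Ico_consecutive 0 n (n + n))
      hγ.measurable
    refine h1.comp (φ := fun z => ∑ i : Fin n, z ⟨i, Finset.mem_range.2 i.2⟩ • x i)
      (ψ := fun z => ∑ i : Fin n, z ⟨n + i, Finset.mem_Ico.2 ⟨by lia, by lia⟩⟩ • x i) ?_ ?_ <;>
    fun_prop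
  have htail : ∀ s : ℝ, P {ω | s < ‖X ω‖} = P {ω | s < ‖Y ω‖} := fun s => by
    have hs : MeasurableSet {x : E | s < ‖x‖} := measurableSet_lt measurable_const hn
    have h1 := congrArg (fun μ => μ {x : E | s < ‖x‖}) hlaw
    simp only [Measure.map_apply hX hs, Measure.map_apply hY hs] at h1
    exact h1
  have hD : MeasurableSet {z : E × E | ‖z.1‖ ≤ a ∧ b < ‖z.2‖} :=
    (measurableSet_le (hn.comp measurable_fst) measurable_const).inter
      (measurableSet_lt measurable_const (hn.comp measurable_snd))
  have hrot := congrArg (fun μ => μ {z : E × E | ‖z.1‖ ≤ a ∧ b < ‖z.2‖}) (hγ.map_rotation x)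
  have hXY : Measurable fun ω => ((√2)⁻¹ • (X ω + Y ω), (√2)⁻¹ • (X ω - Y ω)) :=
    ((hX.add hY).const_smul _).prodMk ((hX.sub hY).const_smul _)
  rw [Measure.map_apply (hX.prodMk hY) hD, Measure.map_apply hXY hD] at hrot
  calc P {ω | ‖X ω‖ ≤ a} * P {ω | b < ‖X ω‖}
      = P {ω | ‖X ω‖ ≤ a} * P {ω | b < ‖Y ω‖} := by rw [htail]
    _ = P ({ω | ‖X ω‖ ≤ a} ∩ {ω | b < ‖Y ω‖}) :=
        (hind.measure_inter_preimage_eq_mul {x | ‖x‖ ≤ a} {x | b < ‖x‖}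
          (measurableSet_le hn measurable_const) (measurableSet_lt measurable_const hn)).symm
    _ = P {ω | ‖(√2)⁻¹ • (X ω + Y ω)‖ ≤ a ∧ b < ‖(√2)⁻¹ • (X ω - Y ω)‖} := hrot
    _ ≤ P ({ω | c < ‖X ω‖} ∩ {ω | c < ‖Y ω‖}) := by
        refine measure_mono fun ω hω => ?_
        obtain ⟨h1, h2⟩ := hω
        have h3 := Real.rpow_lt_rpow hb h2 hr
        have h4 := Real.rpow_le_rpow (hnn _) h1 hr.le
        have hhalf : ∀ z : E, √2 • z = (√2)⁻¹ • z + (√2)⁻¹ • z := fun z => by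
          rw [← add_smul, ← two_mul, ← div_eq_mul_inv, Real.div_sqrt]
        have e1 : (√2)⁻¹ • (X ω - Y ω) = √2 • X ω - (√2)⁻¹ • (X ω + Y ω) := by
          rw [hhalf, smul_sub, smul_add]
          abel
        have e2 : (√2)⁻¹ • (X ω - Y ω) = -(√2 • Y ω - (√2)⁻¹ • (X ω + Y ω)) := by
          rw [hhalf, smul_sub, smul_add]
          abel
        have hlt : ∀ z : E, ‖(√2)⁻¹ • (X ω - Y ω)‖ ^ r ≤
            2 ^ (r / 2) * ‖z‖ ^ r + ‖(√2)⁻¹ • (X ω + Y ω)‖ ^ r → c < ‖z‖ := fun z hz => by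
          have h5 : (2 : ℝ) ^ (r / 2) * c ^ r < 2 ^ (r / 2) * ‖z‖ ^ r := by linarith
          exact (Real.rpow_lt_rpow_iff hc (hnn z) hr).1 (lt_of_mul_lt_mul_left h5 (by positivity))
        refine ⟨hlt _ ?_, hlt _ ?_⟩
        · rw [e1]
          exact norm_rpow_sqrt_smul_sub_le r _ _
        · rw [e2, IsRNormedSpace.norm_neg r]
          exact norm_rpow_sqrt_smul_sub_le r _ _
    _ = P {ω | c < ‖X ω‖} * P {ω | c < ‖Y ω‖} :=
        hind.measure_inter_preimage_eq_mul {x | c < ‖x‖} {x | c < ‖x‖}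
          (measurableSet_lt measurable_const hn) (measurableSet_lt measurable_const hn)
    _ = P {ω | c < ‖X ω‖} ^ 2 := by rw [← htail, sq]

omit [IsProbabilityMeasure P] in
/-- Moment bound for a random variable whose tails decay geometrically along a geometric
sequence. -/
theorem lintegral_rpow_le_of_geometric_tail {f : Ω → ℝ} (hf : Measurable f)
    {a κ q : ℝ} {δ : ℝ≥0∞} (ha : 0 < a) (hκ : 1 < κ) (hq : 0 < q)
    (hδ : δ * ENNReal.ofReal (κ ^ q) ≤ 2⁻¹) (h0 : P {ω | a < f ω} ≤ δ)
    (h1 : ∀ c, a ≤ c → P {ω | κ * c < f ω} ≤ δ * P {ω | c < f ω}) (hP : P Set.univ ≤ 1) :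
    ∫⁻ ω, ENNReal.ofReal (f ω) ^ q ∂P ≤ 2 * ENNReal.ofReal a ^ q := by
  have hκ0 : 0 < κ := zero_lt_one.trans hκ
  have htail : ∀ n : ℕ, P {ω | κ ^ n * a < f ω} ≤ δ ^ (n + 1) := fun n => by
    induction n with
    | zero => simpa using h0
    | succ n ih =>
      have h2 := h1 (κ ^ n * a) (le_mul_of_one_le_left ha.le (one_le_pow₀ hκ.le))
      rw [← mul_assoc, ← pow_succ'] at h2
      refine h2.trans ?_
      rw [pow_succ' δ (n + 1)]
      gcongr
  -- Where f > a, the value lies in a shell κ^n a < f ≤ κ^(n+1) a, on which its upper end bounds f.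
  -- After integration the n-th term is at most a^q (δ κ^q)^(n+1) ≤ a^q 2^-(n+1), and these add up
  -- to a^q.
  have hpt : ∀ ω, ENNReal.ofReal (f ω) ^ q ≤ ENNReal.ofReal a ^ q +
      ∑' n : ℕ, {ω | κ ^ n * a < f ω}.indicator
        (fun _ => ENNReal.ofReal (κ ^ (n + 1) * a) ^ q) ω := fun ω => by
    rcases le_or_gt (f ω) a with h | h
    · exact le_add_right (ENNReal.rpow_le_rpow (ENNReal.ofReal_le_ofReal h) hq.le)
    · obtain ⟨n, hn1, hn2⟩ : ∃ n : ℕ, κ ^ n < f ω / a ∧ f ω / a ≤ κ ^ (n + 1) := by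
        obtain ⟨m, hm1, hm2⟩ := exists_mem_Ioc_zpow (zero_lt_one.trans ((one_lt_div ha).2 h)) hκ
        have hm : 0 < m + 1 := by
          by_contra! hm
          exact absurd (((one_lt_div ha).2 h).trans_le hm2) (zpow_le_one_of_nonpos₀ hκ.le hm).not_gt
        lift m to ℕ using Int.lt_add_one_iff.1 hm
        exact ⟨m, by exact_mod_cast hm1, by exact_mod_cast hm2⟩
      rw [lt_div_iff₀ ha] at hn1
      rw [div_le_iff₀ ha] at hn2
      refine le_add_left (le_trans ?_ (ENNReal.le_tsum n))
      rw [Set.indicator_of_mem (by exact hn1)]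
      exact ENNReal.rpow_le_rpow (ENNReal.ofReal_le_ofReal hn2) hq.le
  have hms : ∀ n : ℕ, MeasurableSet {ω | κ ^ n * a < f ω} := fun n =>
    measurableSet_lt measurable_const hf
  calc ∫⁻ ω, ENNReal.ofReal (f ω) ^ q ∂P
      ≤ ∫⁻ ω, (ENNReal.ofReal a ^ q + ∑' n : ℕ, {ω | κ ^ n * a < f ω}.indicator
        (fun _ => ENNReal.ofReal (κ ^ (n + 1) * a) ^ q) ω) ∂P := lintegral_mono hpt
    _ = ENNReal.ofReal a ^ q * P Set.univ + ∑' n : ℕ,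
          ENNReal.ofReal (κ ^ (n + 1) * a) ^ q * P {ω | κ ^ n * a < f ω} := by
        rw [lintegral_add_left measurable_const, lintegral_const,
          lintegral_tsum fun n => (measurable_const.indicator (hms n)).aemeasurable]
        simp_rw [lintegral_indicator_const (hms _)]
    _ ≤ ENNReal.ofReal a ^ q + ∑' n : ℕ, ENNReal.ofReal a ^ q * 2⁻¹ ^ (n + 1) := by
        refine add_le_add (mul_le_of_le_one_right' hP) (ENNReal.tsum_le_tsum fun n => ?_)
        have e : ENNReal.ofReal (κ ^ (n + 1) * a) ^ q =
            ENNReal.ofReal a ^ q * ENNReal.ofReal (κ ^ q) ^ (n + 1) := by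
          rw [ENNReal.ofReal_mul (by positivity), ENNReal.mul_rpow_of_nonneg _ _ hq.le, mul_comm,
            ENNReal.ofReal_pow hκ0.le, ← ENNReal.ofReal_rpow_of_pos hκ0, ← ENNReal.rpow_natCast,
            ← ENNReal.rpow_natCast, ← ENNReal.rpow_mul, ← ENNReal.rpow_mul, mul_comm q]
        rw [e, mul_assoc]
        gcongr
        calc ENNReal.ofReal (κ ^ q) ^ (n + 1) * P {ω | κ ^ n * a < f ω}
            ≤ ENNReal.ofReal (κ ^ q) ^ (n + 1) * δ ^ (n + 1) := by gcongr; exact htail n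
          _ = (δ * ENNReal.ofReal (κ ^ q)) ^ (n + 1) := by rw [mul_pow, mul_comm]
          _ ≤ 2⁻¹ ^ (n + 1) := by gcongr
    _ = 2 * ENNReal.ofReal a ^ q := by
        rw [ENNReal.tsum_mul_left, ENNReal.tsum_geometric_add_one, ENNReal.one_sub_inv_two, inv_inv,
          ENNReal.inv_mul_cancel two_ne_zero ENNReal.ofNat_ne_top, mul_one, two_mul]

/-- The Kahane–Khintchine inequality for Gaussian sums in `r`-normed spaces. -/
theorem IsGaussianSequence.exists_lpQuasiNorm_le (E) [AddCommGroup E] [Module ℝ E] [Norm E]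
    [MetricSpace E] [IsRNormedSpace r E] [IsTopologicalAddGroup E] [ContinuousSMul ℝ E]
    [MeasurableSpace E] [BorelSpace E] [SecondCountableTopology E]
    (hγ : IsGaussianSequence γ P) {p q : ℝ} (hp : 0 < p) (hq : 0 < q) :
    ∃ C : ℝ≥0∞, C ≠ ∞ ∧ C ≠ 0 ∧ ∀ (n : ℕ) (x : Fin n → E),
      lpQuasiNorm q P (fun ω => ∑ i : Fin n, γ i ω • x i) ≤
        C * lpQuasiNorm p P (fun ω => ∑ i : Fin n, γ i ω • x i) := by
  have hr : 0 < r := IsRNormedSpace.r_pos E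
  have hr1 : r ≤ 1 := IsRNormedSpace.r_le_one E
  have hnn : ∀ x : E, 0 ≤ ‖x‖ := IsRNormedSpace.norm_nonneg r
  have hn : Measurable fun x : E => ‖x‖ := (IsRNormedSpace.continuous_norm r).measurable
  -- This makes κ^r = 3 ≥ 1 + 2^(r/2), so Fernique's inequality applies with levels a ≤ c and b = κ
  -- c.
  set κ : ℝ := 3 ^ (1 / r)
  have hκ : 1 < κ := Real.one_lt_rpow (by norm_num) (by positivity)
  have hκ0 : 0 < κ := zero_lt_one.trans hκ
  have hκr : κ ^ r = 3 := by
    rw [← Real.rpow_mul (by norm_num), one_div_mul_cancel hr.ne', Real.rpow_one]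
  set K : ℝ≥0∞ := ENNReal.ofReal (κ ^ q)
  have hK1 : 1 ≤ K := ENNReal.one_le_ofReal.2 (Real.one_le_rpow hκ.le hq.le)
  have hKtop : K ≠ ∞ := ENNReal.ofReal_ne_top
  -- The tails must shrink by δ with δ κ^q = ½. Fernique's inequality loses a factor 2, because
  -- P(‖X‖ ≤ a) is only known to be at least ½; hence ε = δ/2 below.
  set δ : ℝ≥0∞ := 2⁻¹ * K⁻¹
  have hδK : δ * K = 2⁻¹ := by
    rw [mul_assoc, ENNReal.inv_mul_cancel (zero_lt_one.trans_le hK1).ne' hKtop, mul_one]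
  have hδ : δ ≤ 2⁻¹ := mul_le_of_le_one_right' (ENNReal.inv_le_one.2 hK1)
  have hδ0 : δ ≠ 0 := mul_ne_zero (by simp) (by simpa using hKtop)
  set ε : ℝ≥0∞ := 2⁻¹ * δ
  have hεδ : 2 * ε = δ := by
    rw [← mul_assoc, ENNReal.mul_inv_cancel two_ne_zero ENNReal.ofNat_ne_top, one_mul]
  have hε : ε ≤ 2⁻¹ := (mul_le_of_le_one_left' (by simp)).trans hδ
  have hεδ' : ε ≤ δ := mul_le_of_le_one_left' (by simp)
  have hε0 : ε ≠ 0 := mul_ne_zero (by simp) hδ0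
  have hεtop : ε ≠ ∞ := ne_top_of_le_ne_top (by simp) hε
  set η : ℝ≥0∞ := ε ^ (1 / p)
  have hη0 : η ≠ 0 := by simp [η, hε0, hεtop]
  have hηtop : η ≠ ∞ := by simp [η, hε0, hεtop]
  have hηp : η ^ p = ε := by
    rw [← ENNReal.rpow_mul, one_div_mul_cancel hp.ne', ENNReal.rpow_one]
  refine ⟨2 ^ (1 / q) * η⁻¹, ENNReal.mul_ne_top (by simp) (by simpa using hη0),
    mul_ne_zero (by simp) (by simpa using hηtop), fun n x => ?_⟩
  set X : Ω → E := fun ω => ∑ i : Fin n, γ i ω • x i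
  have hX : Measurable X :=
    IsGaussianFamily.measurable_sum_smul (hγ.isGaussianFamily_comp fun i j h => Fin.ext h) x
  rcases eq_or_ne (lpQuasiNorm p P X) 0 with h0 | h0
  · have h1 := lpQuasiNorm_rpow (P := P) hp X
    rw [h0, ENNReal.zero_rpow_of_pos hp, eq_comm, lintegral_eq_zero_iff (by fun_prop)] at h1
    refine le_of_eq_of_le ?_ zero_le
    rw [← ENNReal.rpow_eq_zero_iff_of_pos hq, lpQuasiNorm_rpow hq,
      lintegral_eq_zero_iff (by fun_prop)]
    filter_upwards [h1] with ω hω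
    simp only [Pi.zero_apply, ENNReal.rpow_eq_zero_iff_of_pos hp] at hω
    simp [hω, hq]
  rcases eq_or_ne (lpQuasiNorm p P X) ∞ with htop | htop
  · rw [htop, ENNReal.mul_top]
    · exact le_top
    · exact mul_ne_zero (by simp) (by simpa using hηtop)
  set A := lpQuasiNorm p P X
  have hA0 : η⁻¹ * A ≠ 0 := mul_ne_zero (by simpa using hηtop) h0
  have hAtop : η⁻¹ * A ≠ ∞ := ENNReal.mul_ne_top (by simpa using hη0) htop
  -- With this level Markov's inequality gives P(‖X‖ > a) ≤ η^p = ε. The cases A = 0 and A = ∞ were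
  -- removed so that a is positive and represents η⁻¹ A.
  set a : ℝ := (η⁻¹ * A).toReal
  have ha : 0 < a := ENNReal.toReal_pos hA0 hAtop
  have haA : ENNReal.ofReal a = η⁻¹ * A := ENNReal.ofReal_toReal hAtop
  have hPa : P {ω | a < ‖X ω‖} ≤ ε := by
    refine (measure_lt_norm_le hn hp hX.aemeasurable ha).trans_eq ?_
    rw [haA, ← hηp]
    congr 1
    rw [eq_comm, ENNReal.eq_div_iff hA0 hAtop, mul_right_comm, ENNReal.inv_mul_cancel hη0 hηtop,
      one_mul]
  have hPa' : 2⁻¹ ≤ P {ω | ‖X ω‖ ≤ a} := by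
    have hms : MeasurableSet {ω | a < ‖X ω‖} := measurableSet_lt measurable_const (hn.comp hX)
    have e : {ω | ‖X ω‖ ≤ a} = {ω | a < ‖X ω‖}ᶜ := by ext; simp
    rw [e, prob_compl_eq_one_sub hms, ← ENNReal.one_sub_inv_two]
    exact tsub_le_tsub_left (hPa.trans hε) 1
  have htail : ∀ c, a ≤ c → P {ω | κ * c < ‖X ω‖} ≤ δ * P {ω | c < ‖X ω‖} := fun c hc => by
    have hc0 : 0 ≤ c := ha.le.trans hc
    have h2 := hγ.measure_mul_measure_le_sq r x (a := a) (b := κ * c) (c := c) (by positivity) hc0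
      (by
        have h3 : a ^ r ≤ c ^ r := Real.rpow_le_rpow ha.le hc hr.le
        have h4 : (2 : ℝ) ^ (r / 2) ≤ 2 :=
          (Real.rpow_le_rpow_of_exponent_le one_le_two (by linarith)).trans_eq (Real.rpow_one 2)
        have h5 : 2 ^ (r / 2) * c ^ r ≤ 2 * c ^ r := by gcongr
        rw [Real.mul_rpow hκ0.le hc0, hκr]
        linarith)
    have h6 : P {ω | c < ‖X ω‖} ≤ ε :=
      (measure_mono fun ω (hω : c < ‖X ω‖) => hc.trans_lt hω).trans hPa
    calc P {ω | κ * c < ‖X ω‖} = 2 * (2⁻¹ * P {ω | κ * c < ‖X ω‖}) := by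
          rw [← mul_assoc, ENNReal.mul_inv_cancel two_ne_zero ENNReal.ofNat_ne_top, one_mul]
      _ ≤ 2 * (P {ω | ‖X ω‖ ≤ a} * P {ω | κ * c < ‖X ω‖}) := by gcongr
      _ ≤ 2 * (P {ω | c < ‖X ω‖} * P {ω | c < ‖X ω‖}) := by rw [← sq]; gcongr
      _ ≤ 2 * (ε * P {ω | c < ‖X ω‖}) := by gcongr
      _ = δ * P {ω | c < ‖X ω‖} := by rw [← mul_assoc, hεδ]
  have hfin := lintegral_rpow_le_of_geometric_tail (hn.comp hX) ha hκ hq hδK.le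
    (hPa.trans hεδ') htail prob_le_one
  rw [lpQuasiNorm_le_iff hq, mul_assoc, ← haA, ENNReal.mul_rpow_of_nonneg _ _ hq.le,
    ← ENNReal.rpow_mul, one_div_mul_cancel hq.ne', ENNReal.rpow_one]
  exact hfin

end Kahane

/-! ### Convergence of Gaussian series -/

section Convergence

section Algebra

variable {Ω E : Type*} [AddCommGroup E] [Module ℝ E]

theorem gaussianSum_eq_sum_fin (γ : ℕ → Ω → ℝ) (x : ℕ → E) (N : ℕ) (ω : Ω) :
    gaussianSum γ x N ω = ∑ n : Fin N, γ n ω • x n :=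
  Finset.sum_range _

/-- Zeroing coefficients instead of shifting indices keeps an increment a Gaussian sum over the same
γ, so the Kahane–Khintchine and Lévy inequalities apply to it directly. -/
theorem gaussianSum_sub_gaussianSum (γ : ℕ → Ω → ℝ) (x : ℕ → E) {M N : ℕ} (h : M ≤ N) (ω : Ω) :
    gaussianSum γ x N ω - gaussianSum γ x M ω =
      gaussianSum γ (fun n => if n < M then 0 else x n) N ω := by
  have h0 : ∑ n ∈ Finset.range M, γ n ω • (if n < M then 0 else x n) = 0 :=
    Finset.sum_eq_zero fun n hn => by simp [Finset.mem_range.1 hn]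
  rw [gaussianSum, gaussianSum, gaussianSum, ← Finset.sum_range_add_sum_Ico _ h,
    ← Finset.sum_range_add_sum_Ico _ h, add_sub_cancel_left, h0, zero_add]
  refine Finset.sum_congr rfl fun n hn => ?_
  rw [if_neg (Finset.mem_Ico.1 hn).1.not_gt]

/-- The sequence `X` is Cauchy in `L^p(Ω; E)`. -/
def LpCauchy [MeasurableSpace Ω] [Norm E] (p : ℝ) (P : Measure Ω) (X : ℕ → Ω → E) : Prop :=
  ∀ ε : ℝ≥0∞, 0 < ε → ∃ M, ∀ m n, M ≤ m → m ≤ n →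
    lpQuasiNorm p P (fun ω => X n ω - X m ω) ≤ ε

end Algebra

variable {Ω : Type*} [MeasurableSpace Ω] {P : Measure Ω} {γ : ℕ → Ω → ℝ}

theorem IsGaussianSequence.lpQuasiNorm_lt_top (hγ : IsGaussianSequence γ P) {p : ℝ} (hp : 0 < p)
    (n : ℕ) : lpQuasiNorm p P (γ n) < ∞ := by
  have h := memLp_id_gaussianReal (μ := 0) (v := 1) p.toNNReal
  rw [← hγ.map_eq n, memLp_map_measure_iff (by fun_prop) (hγ.measurable n).aemeasurable] at h
  have h1 := lintegral_rpow_enorm_lt_top_of_eLpNorm_lt_top (by simpa using hp) (by simp)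
    h.eLpNorm_lt_top
  rw [← ENNReal.rpow_lt_top_iff_of_pos hp, lpQuasiNorm_rpow hp]
  simpa [hp.le, ← ofReal_norm] using h1

theorem IsGaussianSequence.measurable_gaussianSum {E : Type*} [AddCommGroup E] [Module ℝ E]
    [TopologicalSpace E] [IsTopologicalAddGroup E] [ContinuousSMul ℝ E] [MeasurableSpace E]
    [BorelSpace E] [SecondCountableTopology E] (hγ : IsGaussianSequence γ P) (x : ℕ → E) (N : ℕ) : Measurable (gaussianSum γ x N) := by
  have := hγ.measurable
  unfold gaussianSum
  fun_prop

variable (r : ℝ) {E : Type*} [AddCommGroup E] [Module ℝ E] [Norm E] [MetricSpace E]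
  [IsRNormedSpace r E]

include r

theorem lpQuasiNorm_smul_const {p : ℝ} (hp : 0 < p) (g : Ω → ℝ) (x : E) :
    lpQuasiNorm p P (fun ω => g ω • x) = lpQuasiNorm p P g * ENNReal.ofReal ‖x‖ := by
  refine (ENNReal.rpow_left_injective hp.ne') ?_
  simp only
  rw [ENNReal.mul_rpow_of_nonneg _ _ hp.le, lpQuasiNorm_rpow hp, lpQuasiNorm_rpow hp,
    ← lintegral_mul_const' _ _ (by simp [hp.le])]
  refine lintegral_congr fun ω => ?_
  rw [IsRNormedSpace.norm_smul r, ENNReal.ofReal_mul (abs_nonneg _),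
    ENNReal.mul_rpow_of_nonneg _ _ hp.le, Real.norm_eq_abs]

variable [IsTopologicalAddGroup E] [ContinuousSMul ℝ E] [MeasurableSpace E] [BorelSpace E]
  [SecondCountableTopology E]

theorem IsGaussianSequence.lpQuasiNorm_gaussianSum_lt_top (hγ : IsGaussianSequence γ P) {p : ℝ}
    (hp : 0 < p) (x : ℕ → E) (N : ℕ) : lpQuasiNorm p P (gaussianSum γ x N) < ∞ := by
  induction N with
  | zero =>
    have h : gaussianSum γ x 0 = fun _ => (0 : E) := by ext; simp [gaussianSum]
    rw [h, lpQuasiNorm_zero r hp]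
    exact ENNReal.zero_lt_top
  | succ N ih =>
    have h : gaussianSum γ x (N + 1) = fun ω => gaussianSum γ x N ω + γ N ω • x N := by
      ext; simp [gaussianSum, Finset.sum_range_succ]
    rw [h]
    refine lpQuasiNorm_add_lt_top r hp (hγ.measurable_gaussianSum x N).aemeasurable
      ((hγ.measurable N).smul_const _).aemeasurable ih ?_
    rw [lpQuasiNorm_smul_const r hp]
    exact ENNReal.mul_lt_top (hγ.lpQuasiNorm_lt_top hp N) ENNReal.ofReal_lt_top

/-- Lévy's maximal inequality for Gaussian sums in `r`-normed spaces. -/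
theorem IsGaussianSequence.measure_exists_lt_norm_le (hγ : IsGaussianSequence γ P) (x : ℕ → E)
    {t : ℝ} (ht : 0 ≤ t) (n : ℕ) :
    P {ω | ∃ k ≤ n, t < ‖gaussianSum γ x k ω‖} ≤
      2 * P {ω | 2 ^ (1 - 1 / r) * t < ‖gaussianSum γ x n ω‖} := by
  have hr : 0 < r := IsRNormedSpace.r_pos E
  have hnn : ∀ x : E, 0 ≤ ‖x‖ := IsRNormedSpace.norm_nonneg r
  have hn : Measurable fun x : E => ‖x‖ := (IsRNormedSpace.continuous_norm r).measurable
  set c : ℝ := 2 ^ (1 - 1 / r) * t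
  let s : ℕ → (ℕ → ℝ) → E := fun k z => ∑ i ∈ Finset.range k, z i • x i
  have hs : ∀ k, Measurable (s k) := fun k => by fun_prop
  -- First passage above level t at time k; these events are disjoint.
  let A : ℕ → Set (ℕ → ℝ) := fun k => {z | t < ‖s k z‖ ∧ ∀ j < k, ‖s j z‖ ≤ t}
  have hA : ∀ k, MeasurableSet (A k) := fun k => by
    refine (measurableSet_lt measurable_const (hn.comp (hs k))).inter ?_
    have e : {z : ℕ → ℝ | ∀ j < k, ‖s j z‖ ≤ t} = ⋂ j, ⋂ (_ : j < k), {z | ‖s j z‖ ≤ t} := by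
      ext; simp
    change MeasurableSet {z : ℕ → ℝ | ∀ j < k, ‖s j z‖ ≤ t}
    rw [e]
    exact MeasurableSet.iInter fun j => MeasurableSet.iInter fun _ =>
      measurableSet_le (hn.comp (hs j)) measurable_const
  let B : Set (ℕ → ℝ) := {z | c < ‖s n z‖}
  have hB : MeasurableSet B := measurableSet_lt measurable_const (hn.comp (hs n))
  set G : Ω → ℕ → ℝ := fun ω i => γ i ω
  have hG : Measurable G := measurable_pi_lambda _ hγ.measurable
  have hdisj : Pairwise (Function.onFun Disjoint A) := by
    intro j k hjk
    refine Set.disjoint_left.2 fun z hj hk => ?_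
    rcases lt_or_gt_of_ne hjk with h | h
    · exact (hk.2 j h).not_gt hj.1
    · exact (hj.2 k h).not_gt hk.1
  have hone : ∀ k ≤ n, P (G ⁻¹' A k) ≤ 2 * P (G ⁻¹' (A k ∩ B)) := fun k hk => by
    -- Reflection: flipping the signs from index k on preserves the law and all sums up to time k,
    -- while the two final sums add up to 2 s_k. Hence one of them is large whenever s_k is.
    have hγ' := hγ.ite_neg k
    set G' : Ω → ℕ → ℝ := fun ω i => if i < k then γ i ω else -γ i ω with hG'def
    have hG' : Measurable G' := measurable_pi_lambda _ hγ'.measurable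
    have hsj : ∀ j ≤ k, ∀ ω, s j (G' ω) = s j (G ω) := fun j hj ω =>
      Finset.sum_congr rfl fun i hi => by
        simp [G', G, (Finset.mem_range.1 hi).trans_le hj]
    have hsn : ∀ ω, s n (G ω) + s n (G' ω) = (2 : ℝ) • s k (G ω) := fun ω => by
      simp only [s]
      rw [← Finset.sum_add_distrib, ← Finset.sum_range_add_sum_Ico _ hk, Finset.smul_sum]
      rw [Finset.sum_eq_zero (s := Finset.Ico k n), add_zero]
      · refine Finset.sum_congr rfl fun i hi => ?_
        simp [G', G, Finset.mem_range.1 hi, two_smul]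
      · intro i hi
        simp [G', G, (Finset.mem_Ico.1 hi).1.not_gt]
    have heq : P (G' ⁻¹' (A k ∩ B)) = P (G ⁻¹' (A k ∩ B)) := by
      rw [← Measure.map_apply hG' ((hA k).inter hB), ← Measure.map_apply hG ((hA k).inter hB)]
      exact congrArg (fun μ => μ (A k ∩ B)) (hγ'.map_eq_map hγ)
    have hsub : G ⁻¹' A k ⊆ G ⁻¹' (A k ∩ B) ∪ G' ⁻¹' (A k ∩ B) := by
      intro ω hω
      have hω' : G' ω ∈ A k := by
        refine ⟨?_, fun j hj => ?_⟩
        · rw [hsj k le_rfl]; exact hω.1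
        · rw [hsj j hj.le]; exact hω.2 j hj
      by_contra hcon
      rw [Set.mem_union, not_or] at hcon
      have h1 : ‖s n (G ω)‖ ≤ c := not_lt.1 fun h => hcon.1 ⟨hω, h⟩
      have h2 : ‖s n (G' ω)‖ ≤ c := not_lt.1 fun h => hcon.2 ⟨hω', h⟩
      have h3 := IsRNormedSpace.norm_add_rpow_le (r := r) (s n (G ω)) (s n (G' ω))
      rw [hsn, IsRNormedSpace.norm_smul r, abs_two, Real.mul_rpow zero_le_two (hnn _)] at h3
      have h4 := Real.rpow_le_rpow (hnn _) h1 hr.le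
      have h5 := Real.rpow_le_rpow (hnn _) h2 hr.le
      have h6 := Real.rpow_lt_rpow ht hω.1 hr
      -- This identity dictates the factor 2^(1 - 1/r): if both final sums had norm at most c, then
      -- ‖s_k‖ would be at most t.
      have h7 : c ^ r + c ^ r = 2 ^ r * t ^ r := by
        rw [← two_mul, Real.mul_rpow (by positivity) ht, ← Real.rpow_mul zero_le_two, sub_mul,
          one_div_mul_cancel hr.ne', one_mul, Real.rpow_sub_one two_ne_zero]
        ring
      have h8 : (2 : ℝ) ^ r * t ^ r < 2 ^ r * ‖s k (G ω)‖ ^ r := by gcongr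
      linarith
    calc P (G ⁻¹' A k) ≤ P (G ⁻¹' (A k ∩ B)) + P (G' ⁻¹' (A k ∩ B)) :=
          (measure_mono hsub).trans (measure_union_le _ _)
      _ = 2 * P (G ⁻¹' (A k ∩ B)) := by rw [heq, two_mul]
  have hcover : {ω | ∃ k ≤ n, t < ‖gaussianSum γ x k ω‖} ⊆
      ⋃ k ∈ Finset.range (n + 1), G ⁻¹' A k := by
    classical
    rintro ω ⟨k, hk, hkt⟩
    have hex : ∃ k, t < ‖gaussianSum γ x k ω‖ := ⟨k, hkt⟩
    refine Set.mem_iUnion₂.2 ⟨Nat.find hex, Finset.mem_range.2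
      (Nat.lt_succ_of_le ((Nat.find_min' hex hkt).trans hk)), Nat.find_spec hex, fun j hj => ?_⟩
    exact not_lt.1 (Nat.find_min hex hj)
  calc P {ω | ∃ k ≤ n, t < ‖gaussianSum γ x k ω‖}
      ≤ ∑ k ∈ Finset.range (n + 1), P (G ⁻¹' A k) :=
        (measure_mono hcover).trans (measure_biUnion_finset_le _ _)
    _ ≤ ∑ k ∈ Finset.range (n + 1), 2 * P (G ⁻¹' (A k ∩ B)) :=
        Finset.sum_le_sum fun k hk => hone k (Nat.lt_succ_iff.1 (Finset.mem_range.1 hk))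
    _ = 2 * P (⋃ k ∈ Finset.range (n + 1), G ⁻¹' (A k ∩ B)) := by
        rw [← Finset.mul_sum, measure_biUnion_finset]
        · exact fun j _ k _ hjk => Disjoint.preimage _
            ((hdisj hjk).mono Set.inter_subset_left Set.inter_subset_left)
        · exact fun k _ => hG ((hA k).inter hB)
    _ ≤ 2 * P {ω | c < ‖gaussianSum γ x n ω‖} := by
        gcongr
        exact Set.iUnion₂_subset fun k _ ω hω => hω.2

omit [ContinuousSMul ℝ E] in
theorem LpConverges.lpCauchy {p : ℝ} (hp : 0 < p) {X : ℕ → Ω → E} (hX : ∀ n, AEMeasurable (X n) P)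
    (h : LpConverges p P X) : LpCauchy p P X := by
  obtain ⟨S, hS, -, hlim⟩ := h
  intro ε hε
  obtain ⟨δ, hδ, hadd⟩ := exists_lpQuasiNorm_add_le (Ω := Ω) (P := P) r E hp hε
  obtain ⟨M, hM⟩ := ENNReal.tendsto_atTop_zero.1 hlim δ hδ
  refine ⟨M, fun m n hm hn => ?_⟩
  have h1 := hadd (fun ω => X n ω - S ω) (fun ω => S ω - X m ω) ((hX n).sub hS.aemeasurable)
    (hS.aemeasurable.sub (hX m)) (hM n (hm.trans hn))
    ((lpQuasiNorm_sub_comm r _ _).trans_le (hM m hm))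
  simpa using h1

variable [IsProbabilityMeasure P]

/-- Increments are finite Gaussian sums, and the Kahane–Khintchine constant depends neither on their
length nor on their coefficients. -/
theorem IsGaussianSequence.lpCauchy_of_lpCauchy (hγ : IsGaussianSequence γ P) {p q : ℝ}
    (hp : 0 < p) (hq : 0 < q) {x : ℕ → E} (h : LpCauchy p P (gaussianSum γ x)) :
    LpCauchy q P (gaussianSum γ x) := by
  obtain ⟨C, hC, hC0, hle⟩ := hγ.exists_lpQuasiNorm_le r E hp hq
  intro ε hε
  obtain ⟨M, hM⟩ := h (ε / C) (ENNReal.div_pos hε.ne' hC)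
  refine ⟨M, fun m n hm hn => ?_⟩
  have h1 := hM m n hm hn
  simp_rw [gaussianSum_sub_gaussianSum γ x hn, gaussianSum_eq_sum_fin] at h1 ⊢
  refine (hle _ _).trans ((mul_le_mul_right h1 C).trans_eq ?_)
  exact ENNReal.mul_div_cancel hC0 hC

variable [CompleteSpace E]

omit [IsProbabilityMeasure P] in
-- Lévy's inequality bounds the oscillation after time M by the tail of a single increment, which
-- Markov's inequality makes small; no subsequence is needed.
theorem IsGaussianSequence.ae_exists_tendsto (hγ : IsGaussianSequence γ P) {p : ℝ} (hp : 0 < p)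
    {x : ℕ → E} (h : LpCauchy p P (gaussianSum γ x)) :
    ∀ᵐ ω ∂P, ∃ l, Tendsto (fun N => gaussianSum γ x N ω) atTop (𝓝 l) := by
  have hr : 0 < r := IsRNormedSpace.r_pos E
  have hn : Measurable fun x : E => ‖x‖ := (IsRNormedSpace.continuous_norm r).measurable
  have hnn : ∀ x : E, 0 ≤ ‖x‖ := IsRNormedSpace.norm_nonneg r
  have hosc : ∀ t : ℝ, 0 < t → ∀ᵐ ω ∂P, ∃ M, ∀ k, M ≤ k →
      ‖gaussianSum γ x k ω - gaussianSum γ x M ω‖ ≤ t := by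
    intro t ht
    rw [ae_iff]
    refine le_antisymm (ENNReal.le_of_forall_pos_le_add fun η hη _ => ?_) zero_le
    have hc : 0 < 2 ^ (1 - 1 / r) * t := by positivity
    set c : ℝ := 2 ^ (1 - 1 / r) * t
    have hη' : (0 : ℝ≥0∞) < η / 2 := ENNReal.half_pos (by exact_mod_cast hη.ne')
    -- Markov at level c then gives probability η/2, which Lévy's inequality doubles to η.
    obtain ⟨M, hM⟩ := h (((η : ℝ≥0∞) / 2) ^ (1 / p) * ENNReal.ofReal c)
      (ENNReal.mul_pos (ENNReal.rpow_pos_of_nonneg hη' (by positivity)).ne' (ENNReal.ofReal_pos.2 hc).ne')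
    let D : ℕ → Set Ω := fun n => {ω | ∃ k ≤ n, t < ‖gaussianSum γ
      (fun i => if i < M then 0 else x i) k ω‖}
    have hD : ∀ n, P (D n) ≤ η := fun n => by
      rcases le_total n M with hnM | hnM
      · have h1 : D n = ∅ := by
          refine Set.eq_empty_of_forall_notMem fun ω hω => ?_
          obtain ⟨k, hk, hkt⟩ := hω
          rw [gaussianSum, Finset.sum_eq_zero fun i hi => by
              rw [if_pos ((Finset.mem_range.1 hi).trans_le (hk.trans hnM)), smul_zero],
            (IsRNormedSpace.norm_eq_zero_iff r (0 : E)).2 rfl] at hkt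
          exact hkt.not_ge ht.le
        simp [h1]
      · refine (hγ.measure_exists_lt_norm_le r _ ht.le n).trans ?_
        have h1 := hM M n le_rfl hnM
        simp_rw [gaussianSum_sub_gaussianSum γ x hnM] at h1
        have h2 := measure_lt_norm_le (P := P) hn hp (hγ.measurable_gaussianSum
          (fun i => if i < M then 0 else x i) n).aemeasurable hc
        calc _ ≤ 2 * ((η : ℝ≥0∞) / 2) := by
              refine mul_le_mul_right (h2.trans ?_) 2
              rw [← ENNReal.le_rpow_inv_iff hp, ← one_div]
              exact ENNReal.div_le_of_le_mul h1
          _ = η := ENNReal.mul_div_cancel two_ne_zero ENNReal.ofNat_ne_top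
    have hmono : Monotone D := fun m n hmn ω ⟨k, hk, hkt⟩ => ⟨k, hk.trans hmn, hkt⟩
    calc P {ω | ¬∃ M, ∀ k, M ≤ k → ‖gaussianSum γ x k ω - gaussianSum γ x M ω‖ ≤ t}
        ≤ P (⋃ n, D n) := by
          refine measure_mono fun ω hω => ?_
          have hω' : ¬∀ k, M ≤ k → ‖gaussianSum γ x k ω - gaussianSum γ x M ω‖ ≤ t :=
            fun h' => hω ⟨M, h'⟩
          push Not at hω'
          obtain ⟨k, hk, hkt⟩ := hω'
          rw [gaussianSum_sub_gaussianSum γ x hk] at hkt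
          exact Set.mem_iUnion.2 ⟨k, k, le_rfl, hkt⟩
      _ = ⨆ n, P (D n) := hmono.measure_iUnion
      _ ≤ 0 + η := by rw [zero_add]; exact iSup_le hD
  have hall : ∀ᵐ ω ∂P, ∀ j : ℕ, ∃ M, ∀ k, M ≤ k →
      ‖gaussianSum γ x k ω - gaussianSum γ x M ω‖ ≤ 1 / ((j : ℝ) + 1) :=
    ae_all_iff.2 fun j => hosc _ (by positivity)
  filter_upwards [hall] with ω hω
  refine cauchySeq_tendsto_of_complete (Metric.cauchySeq_iff'.2 fun ε hε => ?_)
  obtain ⟨j, hj⟩ := exists_nat_one_div_lt (Real.rpow_pos_of_pos hε (1 / r))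
  obtain ⟨M, hM⟩ := hω j
  refine ⟨M, fun k hk => ?_⟩
  rw [IsRNormedSpace.dist_eq (r := r)]
  have h1 := Real.rpow_lt_rpow (hnn _) ((hM k hk).trans_lt hj) hr
  rwa [← Real.rpow_mul hε.le, one_div_mul_cancel hr.ne', Real.rpow_one] at h1

/-- A Gaussian series that is Cauchy in some `L^p(Ω; E)` converges almost surely and in all
`L^q(Ω; E)`. -/
theorem IsGaussianSequence.exists_limit (hγ : IsGaussianSequence γ P) {p : ℝ} (hp : 0 < p)
    {x : ℕ → E} (h : LpCauchy p P (gaussianSum γ x)) :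
    ∃ S : Ω → E, (∀ᵐ ω ∂P, Tendsto (fun N => gaussianSum γ x N ω) atTop (𝓝 (S ω))) ∧
      ∀ q : ℝ, 0 < q → LpConvergesTo q P (gaussianSum γ x) S := by
  have hc : Continuous fun x : E => ‖x‖ := IsRNormedSpace.continuous_norm r
  have hmeas := hγ.measurable_gaussianSum x
  choose! S hS using fun ω (hω : ∃ l, Tendsto (fun N => gaussianSum γ x N ω) atTop (𝓝 l)) => hω
  have hlim : ∀ᵐ ω ∂P, Tendsto (fun N => gaussianSum γ x N ω) atTop (𝓝 (S ω)) := by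
    filter_upwards [hγ.ae_exists_tendsto r hp h] with ω hω using hS ω hω
  have hSm : AEStronglyMeasurable S P :=
    aestronglyMeasurable_of_tendsto_ae atTop
      (fun n => (hmeas n).aestronglyMeasurable) hlim
  refine ⟨S, hlim, fun q hq => ?_⟩
  have hconv : Tendsto (fun N => lpQuasiNorm q P fun ω => gaussianSum γ x N ω - S ω) atTop
      (𝓝 0) := by
    refine ENNReal.tendsto_atTop_zero.2 fun ε hε => ?_
    obtain ⟨δ, hδ, hadd⟩ := exists_lpQuasiNorm_add_le (Ω := Ω) (P := P) r E hq hε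
    obtain ⟨M, hM⟩ := hγ.lpCauchy_of_lpCauchy r hp hq h δ hδ
    -- Fatou in the second index of the Cauchy condition: the almost sure limit S is thereby the
    -- limit in every L^q.
    have hMS : lpQuasiNorm q P (fun ω => gaussianSum γ x M ω - S ω) ≤ δ := by
      refine lpQuasiNorm_le_of_tendsto hc hc.measurable hq
        (f := fun n ω => gaussianSum γ x M ω - gaussianSum γ x n ω)
        (fun n => ((hmeas M).sub (hmeas n)).aemeasurable) ?_ (c := fun _ => δ) ?_
        tendsto_const_nhds
      · filter_upwards [hlim] with ω hω using hω.const_sub _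
      · filter_upwards [eventually_ge_atTop M] with n hn
        exact (lpQuasiNorm_sub_comm r _ _).trans_le (hM M n le_rfl hn)
    refine ⟨M, fun n hn => ?_⟩
    have h1 := hadd _ _ ((hmeas n).sub (hmeas M)).aemeasurable
      ((hmeas M).aemeasurable.sub hSm.aemeasurable) (hM M n le_rfl hn) hMS
    simpa using h1
  refine ⟨hSm, ?_, hconv⟩
  obtain ⟨M, hM⟩ := ENNReal.tendsto_atTop_zero.1 hconv 1 one_pos
  have h1 := lpQuasiNorm_add_lt_top r hq (hmeas M).aemeasurable
    (hSm.aemeasurable.sub (hmeas M).aemeasurable)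
    (hγ.lpQuasiNorm_gaussianSum_lt_top r hq x M)
    ((lpQuasiNorm_sub_comm r _ _).trans_lt ((hM M le_rfl).trans_lt ENNReal.one_lt_top))
  simpa using h1

end Convergence

/-! ### Gamma norms, finite rank approximation and orthonormal bases -/

section Radonifying

theorem separableSpace_of_hilbertBasis {H : Type*} [NormedAddCommGroup H] [InnerProductSpace ℝ H]
    (h : HilbertBasis ℕ ℝ H) : TopologicalSpace.SeparableSpace H := by
  rw [← TopologicalSpace.isSeparable_univ_iff]
  have h1 := ((Set.countable_range h).isSeparable.span (R := ℝ)).closure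
  rwa [← Submodule.topologicalClosure_coe, h.dense_span] at h1

variable {Ω : Type*} [MeasurableSpace Ω] {P : Measure Ω}
  {H : Type*} [NormedAddCommGroup H] [InnerProductSpace ℝ H]
  {γ : ℕ → Ω → ℝ} (r : ℝ)

theorem gammaConst_ne_top (p : ℝ) : gammaConst r p ≠ ∞ := ENNReal.ofReal_ne_top

variable {E : Type*} [AddCommGroup E] [Module ℝ E] [Norm E]

theorem lpQuasiNorm_gaussianSum_le_gammaNorm {b : ℕ → H} (hb : Orthonormal ℝ b) (p : ℝ)
    (R : H →ₗ[ℝ] E) (N : ℕ) :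
    lpQuasiNorm p P (gaussianSum γ (fun n => R (b n)) N) ≤ gammaNorm γ P p R := by
  have e : gaussianSum γ (fun n => R (b n)) N = fun ω => ∑ n : Fin N, γ n ω • R (b n) :=
    funext fun ω => gaussianSum_eq_sum_fin γ _ N ω
  rw [e]
  exact le_iSup₂_of_le N (fun i : Fin N => b i)
    (le_iSup_of_le (hb.comp _ Fin.val_injective) le_rfl)

variable [MetricSpace E] [IsRNormedSpace r E] [IsTopologicalAddGroup E] [ContinuousSMul ℝ E]
  [MeasurableSpace E] [BorelSpace E] [SecondCountableTopology E]

include r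

theorem lpQuasiNorm_sum_smul_eq {ι : Type*} [Fintype ι] {g g' : ι → Ω → ℝ}
    (hg : IsGaussianFamily g P) (hg' : IsGaussianFamily g' P) (p : ℝ) (x : ι → E) :
    lpQuasiNorm p P (fun ω => ∑ i, g i ω • x i) = lpQuasiNorm p P (fun ω => ∑ i, g' i ω • x i) := by
  have hF : Measurable fun z : ι → ℝ => ‖∑ i, z i • x i‖ :=
    (IsRNormedSpace.continuous_norm r).measurable.comp (by fun_prop)
  exact lpQuasiNorm_eq_of_map_eq hF (measurable_pi_lambda _ hg.measurable).aemeasurable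
    (measurable_pi_lambda _ hg'.measurable).aemeasurable
    (hg.map_fun_eq_pi.trans hg'.map_fun_eq_pi.symm)

/-- The block b M, …, b (N - 1) is itself an orthonormal system. Its Gaussians start at index M, but
only their joint law matters, so they may be replaced by the initial ones used in `gammaNorm`. -/
theorem IsGaussianSequence.lpQuasiNorm_gaussianSum_sub_le_gammaNorm
    (hγ : IsGaussianSequence γ P) {b : ℕ → H} (hb : Orthonormal ℝ b) (p : ℝ) (R : H →ₗ[ℝ] E)
    {M N : ℕ} (h : M ≤ N) :
    lpQuasiNorm p P (fun ω => gaussianSum γ (fun n => R (b n)) N ω -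
      gaussianSum γ (fun n => R (b n)) M ω) ≤ gammaNorm γ P p R := by
  have hinj : Function.Injective fun i : Fin (N - M) => M + (i : ℕ) :=
    fun i j hij => Fin.ext (Nat.add_left_cancel hij)
  have e : (fun ω => gaussianSum γ (fun n => R (b n)) N ω -
      gaussianSum γ (fun n => R (b n)) M ω) =
      fun ω => ∑ i : Fin (N - M), γ (M + i) ω • R (b (M + i)) := by
    ext ω
    rw [gaussianSum, gaussianSum, ← Finset.sum_range_add_sum_Ico _ h, add_sub_cancel_left,
      Finset.sum_Ico_eq_sum_range, Finset.sum_range]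
  rw [e, lpQuasiNorm_sum_smul_eq r (hγ.isGaussianFamily_comp hinj)
    (hγ.isGaussianFamily_comp Fin.val_injective)]
  exact le_iSup₂_of_le (N - M) (fun i => b (M + i)) (le_iSup_of_le (hb.comp _ hinj) le_rfl)

omit [IsTopologicalAddGroup E] [MeasurableSpace E] [BorelSpace E] [SecondCountableTopology E] in
-- With all coefficients on one line the sum is a scalar Gaussian of variance ∑ c n ^ 2 times x:
-- covariance comparison in V = ℝ.
theorem IsGaussianSequence.lpQuasiNorm_gaussianSum_smul [IsFiniteMeasure P]
    (hγ : IsGaussianSequence γ P) {p : ℝ} (hp : 0 < p) (c : ℕ → ℝ) (x : E) (N : ℕ) :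
    lpQuasiNorm p P (gaussianSum γ (fun n => c n • x) N) =
      ENNReal.ofReal √(∑ n ∈ Finset.range N, c n ^ 2) *
        (lpQuasiNorm p P (γ 0) * ENNReal.ofReal ‖x‖) := by
  set σ := √(∑ n ∈ Finset.range N, c n ^ 2)
  let T : ℝ →L[ℝ] E := (ContinuousLinearMap.id ℝ ℝ).smulRight x
  have h := lpQuasiNorm_sum_eq_of_covariance (P := P) r
    (hγ.isGaussianFamily_comp (Fin.val_injective (n := N)))
    (hγ.isGaussianFamily_comp (Fin.val_injective (n := 1)))
    (v := fun i => c i) (w := fun _ => σ) (fun t => by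
      have hσ : σ ^ 2 = ∑ i : Fin N, c i ^ 2 := by
        rw [Real.sq_sqrt (Finset.sum_nonneg fun n _ => sq_nonneg (c n)), Finset.sum_range]
      simp [mul_pow, hσ, Finset.mul_sum]) p T
  have e1 : gaussianSum γ (fun n => c n • x) N = fun ω => ∑ i : Fin N, γ i ω • T (c i) :=
    funext fun ω => gaussianSum_eq_sum_fin γ _ N ω
  have e2 : (fun ω => ∑ k : Fin 1, γ k ω • T σ) = fun ω => σ • γ 0 ω • x := by
    ext ω
    simp [T, smul_comm σ]
  rw [e1, h, e2, lpQuasiNorm_const_smul r hp, lpQuasiNorm_smul_const r hp,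
    abs_of_nonneg (Real.sqrt_nonneg _)]

variable [IsProbabilityMeasure P]

theorem IsGaussianSequence.exists_gammaNorm_le (E) [AddCommGroup E] [Module ℝ E] [Norm E]
    [MetricSpace E] [IsRNormedSpace r E] [IsTopologicalAddGroup E] [ContinuousSMul ℝ E]
    [MeasurableSpace E] [BorelSpace E] [SecondCountableTopology E]
    (hγ : IsGaussianSequence γ P) {p q : ℝ} (hp : 0 < p) (hq : 0 < q) :
    ∃ C : ℝ≥0∞, C ≠ ∞ ∧ ∀ R : H →ₗ[ℝ] E, gammaNorm γ P q R ≤ C * gammaNorm γ P p R := by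
  obtain ⟨C, hC, -, hle⟩ := hγ.exists_lpQuasiNorm_le r E hp hq
  refine ⟨C, hC, fun R => iSup_le fun N => iSup₂_le fun u hu => ?_⟩
  refine (hle N fun n => R (u n)).trans (mul_le_mul_right ?_ C)
  exact le_iSup₂_of_le N u (le_iSup_of_le hu le_rfl)

variable [CompleteSpace H]

theorem IsGaussianSequence.lpQuasiNorm_truncation_le [SecondCountableTopology H]
    (hγ : IsGaussianSequence γ P) {N M : ℕ} {u : Fin N → H} {b : Fin M → H}
    (hu : Orthonormal ℝ u) (hb : Orthonormal ℝ b) {p : ℝ} (hp : 0 < p) (R : H →L[ℝ] E) :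
    lpQuasiNorm p P (fun ω => ∑ i : Fin N, γ i ω • R (∑ k, ⟪b k, u i⟫ • b k)) ≤
      gammaConst r p * lpQuasiNorm p P (fun ω => ∑ k : Fin M, γ k ω • R (b k)) := by
  obtain ⟨d, z, hz⟩ := exists_complement_covariance hu hb
  let e : Fin N ⊕ Fin d → ℕ := Sum.elim (fun i => i) fun j => N + j
  have he : e.Injective := by
    refine Function.Injective.sumElim (fun i j h => Fin.ext h)
      (fun i j h => Fin.ext (Nat.add_left_cancel h)) fun i j => ?_
    have := i.2
    lia
  exact lpQuasiNorm_sum_le_of_covariance_add r (hγ.isGaussianFamily_comp he)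
    (hγ.isGaussianFamily_comp Fin.val_injective) hz hp R

/-- The `γ^p`-norm of an operator is controlled by the Gaussian sums along one orthonormal
basis. -/
theorem IsGaussianSequence.gammaNorm_le_of_tendsto (hγ : IsGaussianSequence γ P)
    (h : HilbertBasis ℕ ℝ H) {p : ℝ} (hp : 0 < p) (R : H →L[ℝ] E) {c : ℕ → ℝ≥0∞} {C : ℝ≥0∞}
    (hle : ∀ᶠ N in atTop, lpQuasiNorm p P (gaussianSum γ (fun n => R (h n)) N) ≤ c N)
    (hc : Tendsto c atTop (𝓝 C)) :
    gammaNorm γ P p R.toLinearMap ≤ gammaConst r p * C := by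
  have := separableSpace_of_hilbertBasis h
  have : SecondCountableTopology H := UniformSpace.secondCountable_of_separable H
  have hcont : Continuous fun x : E => ‖x‖ := IsRNormedSpace.continuous_norm r
  refine iSup_le fun N => iSup₂_le fun u hu => ?_
  -- Fatou as the basis expansion of each u i is cut at M → ∞; continuity of R gives pointwise
  -- convergence. The bounds c M may vary: they are constant for the supremum in (i) and tend to the
  -- quasi-norm of the limit in (ii).
  refine lpQuasiNorm_le_of_tendsto hcont hcont.measurable hp
    (f := fun M ω => ∑ i : Fin N, γ i ω • R (∑ k : Fin M, ⟪h k, u i⟫ • h k))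
    (fun M => (IsGaussianFamily.measurable_sum_smul
      (hγ.isGaussianFamily_comp Fin.val_injective) _).aemeasurable)
    (Eventually.of_forall fun ω => ?_) (c := fun M => gammaConst r p * c M) ?_
    (ENNReal.Tendsto.const_mul hc (Or.inr (gammaConst_ne_top r p)))
  · refine tendsto_finsetSum _ fun i _ => Tendsto.const_smul ?_ _
    refine (R.continuous.tendsto _).comp ?_
    have h1 := (h.hasSum_repr (u i)).tendsto_sum_nat
    simpa [Finset.sum_range, h.repr_apply_apply] using h1
  · filter_upwards [hle] with M hM
    refine (hγ.lpQuasiNorm_truncation_le r hu (h.orthonormal.comp _ Fin.val_injective) hp R).trans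
      (mul_le_mul_right ?_ _)
    have e : gaussianSum γ (fun n => R (h n)) M = fun ω => ∑ n : Fin M, γ n ω • R (h n) :=
      funext fun ω => gaussianSum_eq_sum_fin γ _ M ω
    rwa [e] at hM

omit [ContinuousSMul ℝ E] [IsProbabilityMeasure P] in
-- The upper half of the continuity of the quasi-norm, from the triangle inequality for its power r
-- ∧ p. It is what keeps the constant sharp when passing from partial sums to S.
theorem exists_tendsto_of_lpConvergesTo {p : ℝ} (hp : 0 < p) {X : ℕ → Ω → E} {S : Ω → E}
    (hX : ∀ n, AEMeasurable (X n) P) (hS : LpConvergesTo p P X S) :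
    ∃ c : ℕ → ℝ≥0∞, (∀ N, lpQuasiNorm p P (X N) ≤ c N) ∧
      Tendsto c atTop (𝓝 (lpQuasiNorm p P S)) := by
  have hs : 0 < min r p := lt_min (IsRNormedSpace.r_pos E) hp
  obtain ⟨hSm, -, hlim⟩ := hS
  refine ⟨fun N => (lpQuasiNorm p P S ^ min r p +
    lpQuasiNorm p P (fun ω => X N ω - S ω) ^ min r p) ^ (1 / min r p), fun N => ?_, ?_⟩
  · rw [one_div, ENNReal.le_rpow_inv_iff hs]
    have h1 := lpQuasiNorm_add_rpow_le r hp hSm.aemeasurable ((hX N).sub hSm.aemeasurable)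
    simp only [Pi.sub_apply, add_sub_cancel] at h1
    exact h1
  · have h1 : Tendsto (fun N => lpQuasiNorm p P (fun ω => X N ω - S ω) ^ min r p) atTop (𝓝 0) := by
      have h2 := (ENNReal.continuous_rpow_const (y := min r p)).tendsto 0
      rw [ENNReal.zero_rpow_of_pos hs] at h2
      exact h2.comp hlim
    have h3 := (ENNReal.continuous_rpow_const (y := 1 / min r p)).tendsto
      (lpQuasiNorm p P S ^ min r p + 0)
    have e : (lpQuasiNorm p P S ^ min r p + 0) ^ (1 / min r p) = lpQuasiNorm p P S := by
      rw [add_zero, ← ENNReal.rpow_mul, mul_one_div_cancel hs.ne', ENNReal.rpow_one]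
    rw [e] at h3
    exact h3.comp (h1.const_add _)

omit [CompleteSpace H] in
-- For a rank one operator the increments have size proportional to (∑ ⟪b k, g⟫²)^(1/2) over a
-- block, a Cauchy block by Bessel; the property is linear in the operator.
theorem IsGaussianSequence.lpCauchy_of_mem_finiteRank (hγ : IsGaussianSequence γ P)
    {b : ℕ → H} (hb : Orthonormal ℝ b) {p : ℝ} (hp : 0 < p) {T : H →ₗ[ℝ] E}
    (hT : T ∈ finiteRank H E) : LpCauchy p P (gaussianSum γ (fun n => T (b n))) := by
  induction hT using Submodule.span_induction with
  | mem T hT =>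
    obtain ⟨g, x, rfl⟩ := hT
    intro ε hε
    have hK : lpQuasiNorm p P (γ 0) * ENNReal.ofReal ‖x‖ ≠ ∞ :=
      ENNReal.mul_ne_top (hγ.lpQuasiNorm_lt_top hp 0).ne ENNReal.ofReal_ne_top
    set K := lpQuasiNorm p P (γ 0) * ENNReal.ofReal ‖x‖
    obtain ⟨δ, hδ, hδε⟩ : ∃ δ : ℝ, 0 < δ ∧ ENNReal.ofReal δ * K ≤ ε := by
      -- The minimum with 1 keeps δ finite when K = 0 or ε = ∞.
      have h1 : (0 : ℝ≥0∞) < min (ε / K) 1 := lt_min (ENNReal.div_pos hε.ne' hK) one_pos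
      have h2 : min (ε / K) 1 ≠ ∞ := ne_top_of_le_ne_top ENNReal.one_ne_top (min_le_right _ _)
      refine ⟨(min (ε / K) 1).toReal, ENNReal.toReal_pos h1.ne' h2, ?_⟩
      rw [ENNReal.ofReal_toReal h2]
      exact ENNReal.mul_le_of_le_div (min_le_left _ _)
    have hsum : Summable fun n => ⟪b n, g⟫ ^ 2 := by
      simpa using hb.inner_products_summable g
    obtain ⟨M, hM⟩ := Metric.cauchySeq_iff.1 hsum.hasSum.tendsto_sum_nat.cauchySeq (δ ^ 2)
      (by positivity)
    refine ⟨M, fun m n hm hn => ?_⟩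
    simp_rw [gaussianSum_sub_gaussianSum γ _ hn]
    have e : (fun k => if k < m then (0 : E) else rankOne g x (b k)) =
        fun k => (if k < m then (0 : ℝ) else ⟪b k, g⟫) • x := by
      ext k
      split_ifs <;> simp [rankOne, real_inner_comm]
    have h1 := hγ.lpQuasiNorm_gaussianSum_smul r hp (fun k => if k < m then (0 : ℝ) else ⟪b k, g⟫)
      x n
    rw [← e] at h1
    refine h1.trans_le (le_trans (mul_le_mul_left (ENNReal.ofReal_le_ofReal ?_) K) hδε)
    have h2 := hM n (hm.trans hn) m hm
    rw [Real.dist_eq, ← Finset.sum_range_add_sum_Ico _ hn, add_sub_cancel_left] at h2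
    refine Real.sqrt_le_iff.2 ⟨hδ.le, ?_⟩
    rw [← Finset.sum_range_add_sum_Ico _ hn, Finset.sum_eq_zero fun k hk => by
      simp [Finset.mem_range.1 hk], zero_add]
    refine le_trans (le_of_eq ?_) ((le_abs_self _).trans h2.le)
    refine Finset.sum_congr rfl fun k hk => ?_
    rw [if_neg (Finset.mem_Ico.1 hk).1.not_gt]
  | zero =>
    intro ε hε
    refine ⟨0, fun m n _ _ => ?_⟩
    simp [gaussianSum, lpQuasiNorm_zero r hp]
  | add T T' _ _ hT hT' =>
    intro ε hε
    obtain ⟨δ, hδ, hadd⟩ := exists_lpQuasiNorm_add_le (Ω := Ω) (P := P) r E hp hε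
    obtain ⟨M, hM⟩ := hT δ hδ
    obtain ⟨M', hM'⟩ := hT' δ hδ
    refine ⟨max M M', fun m n hm hn => ?_⟩
    have h1 := hadd _ _
      ((hγ.measurable_gaussianSum _ n).sub (hγ.measurable_gaussianSum _ m)).aemeasurable
      ((hγ.measurable_gaussianSum _ n).sub (hγ.measurable_gaussianSum _ m)).aemeasurable
      (hM m n ((le_max_left _ _).trans hm) hn) (hM' m n ((le_max_right _ _).trans hm) hn)
    refine le_trans (le_of_eq ?_) h1
    congr 1
    ext ω
    simp only [gaussianSum, LinearMap.add_apply, smul_add, Finset.sum_add_distrib, Pi.sub_apply]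
    abel
  | smul a T _ hT =>
    intro ε hε
    obtain ⟨M, hM⟩ := hT (ε / ENNReal.ofReal |a|) (ENNReal.div_pos hε.ne' ENNReal.ofReal_ne_top)
    refine ⟨M, fun m n hm hn => ?_⟩
    have e : (fun ω => gaussianSum γ (fun n => (a • T) (b n)) n ω -
        gaussianSum γ (fun n => (a • T) (b n)) m ω) =
        fun ω => a • (gaussianSum γ (fun n => T (b n)) n ω -
          gaussianSum γ (fun n => T (b n)) m ω) := by
      ext ω
      simp only [gaussianSum, LinearMap.smul_apply, smul_comm _ a, ← Finset.smul_sum, smul_sub]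
    rw [e, lpQuasiNorm_const_smul r hp]
    exact (mul_le_mul_right (hM m n hm hn) _).trans ENNReal.mul_div_le

omit [CompleteSpace H] in
-- Increments for R split into those for a finite rank T, which are eventually small, and those for
-- R - T, bounded by its gamma norm uniformly in the block.
theorem IsGaussianSequence.lpCauchy_of_mem_gammaRadonifying (hγ : IsGaussianSequence γ P)
    {b : ℕ → H} (hb : Orthonormal ℝ b) {R : H →ₗ[ℝ] E} (hR : R ∈ gammaRadonifying H E γ P) :
    LpCauchy 2 P (gaussianSum γ (fun n => R (b n))) := by
  intro ε hε
  obtain ⟨δ, hδ, hadd⟩ := exists_lpQuasiNorm_add_le (Ω := Ω) (P := P) r E two_pos hε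
  have h1 : (0 : ℝ≥0∞) < min δ 1 := lt_min hδ one_pos
  have h2 : min δ 1 ≠ ∞ := ne_top_of_le_ne_top ENNReal.one_ne_top (min_le_right _ _)
  obtain ⟨T, hT, hRT⟩ := hR.2 (min δ 1).toReal (ENNReal.toReal_pos h1.ne' h2)
  rw [ENNReal.ofReal_toReal h2] at hRT
  obtain ⟨M, hM⟩ := hγ.lpCauchy_of_mem_finiteRank r hb two_pos hT δ hδ
  refine ⟨M, fun m n hm hn => ?_⟩
  have h3 := hadd _ _
    ((hγ.measurable_gaussianSum _ n).sub (hγ.measurable_gaussianSum _ m)).aemeasurable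
    ((hγ.measurable_gaussianSum _ n).sub (hγ.measurable_gaussianSum _ m)).aemeasurable
    ((hγ.lpQuasiNorm_gaussianSum_sub_le_gammaNorm r hb 2 (R - T) hn).trans
      (hRT.le.trans (min_le_left _ _))) (hM m n hm hn)
  refine le_trans (le_of_eq ?_) h3
  congr 1
  ext ω
  simp only [gaussianSum, LinearMap.sub_apply, smul_sub, Finset.sum_sub_distrib, Pi.sub_apply]
  abel

/-- Let Q project onto the first M basis vectors. Then R Q has finite rank, and the Gaussian sums of
R (1 - Q) along the basis are tails of the series for R, so domination makes its gamma norm small.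
-/
theorem IsGaussianSequence.mem_gammaRadonifying_of_lpCauchy [CompleteSpace E]
    (hγ : IsGaussianSequence γ P) (h : HilbertBasis ℕ ℝ H) {R : H →L[ℝ] E}
    (hR : LpCauchy 2 P (gaussianSum γ (fun n => R (h n)))) :
    R.toLinearMap ∈ gammaRadonifying H E γ P := by
  refine ⟨?_, fun ε hε => ?_⟩
  · obtain ⟨S, -, hS⟩ := hγ.exists_limit r two_pos hR
    obtain ⟨c, hle, hc⟩ := exists_tendsto_of_lpConvergesTo r two_pos
      (fun n => (hγ.measurable_gaussianSum _ n).aemeasurable) (hS 2 two_pos)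
    exact (hγ.gammaNorm_le_of_tendsto r h two_pos R (Eventually.of_forall hle) hc).trans_lt
      (ENNReal.mul_lt_top (gammaConst_ne_top r 2).lt_top (hS 2 two_pos).2.1)
  · have hε' : (0 : ℝ≥0∞) < ENNReal.ofReal ε := ENNReal.ofReal_pos.2 hε
    -- Dividing by the constant absorbs the loss in the domination bound; the extra ½ makes the
    -- final inequality strict.
    obtain ⟨M, hM⟩ := hR (ENNReal.ofReal ε / 2 / gammaConst r 2)
      (ENNReal.div_pos (ENNReal.half_pos hε'.ne').ne' (gammaConst_ne_top r 2))
    refine ⟨∑ k ∈ Finset.range M, rankOne (h k) (R (h k)), Submodule.sum_mem _ fun k _ =>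
      Submodule.subset_span ⟨h k, R (h k), rfl⟩, ?_⟩
    let Q : H →L[ℝ] H := ∑ k ∈ Finset.range M, (innerSL ℝ (h k)).smulRight (h k)
    let R' : H →L[ℝ] E := R.comp (ContinuousLinearMap.id ℝ H - Q)
    have e : R.toLinearMap - ∑ k ∈ Finset.range M, rankOne (h k) (R (h k)) = R'.toLinearMap := by
      ext x
      simp [R', Q, rankOne]
    have hR' : ∀ n, R' (h n) = if n < M then 0 else R (h n) := fun n => by
      have h1 : ∀ k, ⟪h k, h n⟫ = if k = n then (1 : ℝ) else 0 := fun k =>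
        orthonormal_iff_ite.1 h.orthonormal k n
      have h2 : Q (h n) = if n < M then h n else 0 := by
        simp [Q, h1]
      simp only [R', ContinuousLinearMap.comp_apply, sub_apply,
        ContinuousLinearMap.id_apply, h2]
      split_ifs <;> simp
    rw [e]
    have hle : ∀ᶠ N in atTop, lpQuasiNorm 2 P (gaussianSum γ (fun n => R' (h n)) N) ≤
        ENNReal.ofReal ε / 2 / gammaConst r 2 := by
      filter_upwards [eventually_ge_atTop M] with N hN
      have h1 := hM M N le_rfl hN
      simp_rw [gaussianSum_sub_gaussianSum γ _ hN] at h1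
      simp_rw [hR']
      exact h1
    refine (hγ.gammaNorm_le_of_tendsto r h two_pos R' hle tendsto_const_nhds).trans_lt ?_
    refine ENNReal.mul_div_le.trans_lt ?_
    exact ENNReal.half_lt_self hε'.ne' ENNReal.ofReal_ne_top

end Radonifying

end GammaRad

/-! ### Assembly of the two characterizations -/

open GammaRad in
theorem theorem3p6
    {Ω : Type*} [MeasurableSpace Ω] (P : Measure Ω) [IsProbabilityMeasure P]
    {H : Type*} [NormedAddCommGroup H] [InnerProductSpace ℝ H] [CompleteSpace H]
    (r : ℝ) {E : Type*} [AddCommGroup E] [Module ℝ E] [Norm E] [MetricSpace E]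
    [IsRNormedSpace r E] [CompleteSpace E] [TopologicalSpace.SeparableSpace E]
    (γ : ℕ → Ω → ℝ) (hγ : IsGaussianSequence γ P)
    (h : HilbertBasis ℕ ℝ H) (R : H →L[ℝ] E) :
    -- characterization of `γ`-summing operators, for some and for all `p`
    ((R.toLinearMap ∈ gammaSumming H E γ P ↔
        ∃ p : ℝ, 0 < p ∧ (⨆ N, lpQuasiNorm p P (gaussianSum γ (fun n => R (h n)) N)) < ∞) ∧
      (R.toLinearMap ∈ gammaSumming H E γ P ↔
        ∀ p : ℝ, 0 < p → (⨆ N, lpQuasiNorm p P (gaussianSum γ (fun n => R (h n)) N)) < ∞) ∧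
      (R.toLinearMap ∈ gammaSumming H E γ P → ∀ p : ℝ, 0 < p →
        (∀ N, lpQuasiNorm p P (gaussianSum γ (fun n => R (h n)) N) ≤
          gammaNorm γ P p R.toLinearMap) ∧
        gammaNorm γ P p R.toLinearMap ≤
          gammaConst r p * ⨆ N, lpQuasiNorm p P (gaussianSum γ (fun n => R (h n)) N))) ∧
    -- characterization of `γ`-radonifying operators, for some and for all `p`
    ((R.toLinearMap ∈ gammaRadonifying H E γ P ↔
        ∃ p : ℝ, 0 < p ∧ LpConverges p P (gaussianSum γ (fun n => R (h n)))) ∧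
      (R.toLinearMap ∈ gammaRadonifying H E γ P ↔
        ∀ p : ℝ, 0 < p → LpConverges p P (gaussianSum γ (fun n => R (h n)))) ∧
      (R.toLinearMap ∈ gammaRadonifying H E γ P → ∃ S : Ω → E,
        (∀ᵐ ω ∂P, Tendsto (fun N => gaussianSum γ (fun n => R (h n)) N ω) atTop (𝓝 (S ω))) ∧
        ∀ p : ℝ, 0 < p →
          LpConvergesTo p P (gaussianSum γ (fun n => R (h n))) S ∧
          lpQuasiNorm p P S ≤ gammaNorm γ P p R.toLinearMap ∧
          gammaNorm γ P p R.toLinearMap ≤ gammaConst r p * lpQuasiNorm p P S)) := by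
  have : IsTopologicalAddGroup E := IsRNormedSpace.isTopologicalAddGroup r
  have : ContinuousSMul ℝ E := IsRNormedSpace.continuousSMul r
  have : SecondCountableTopology E := UniformSpace.secondCountable_of_separable E
  borelize E
  have hmeas := fun n => (hγ.measurable_gaussianSum (fun n => R (h n)) n).aemeasurable (μ := P)
  have hsup : ∀ p : ℝ, 0 < p → gammaNorm γ P p R.toLinearMap ≤
      gammaConst r p * ⨆ N, lpQuasiNorm p P (gaussianSum γ (fun n => R (h n)) N) := fun p hp =>
    hγ.gammaNorm_le_of_tendsto r h hp R
      (Eventually.of_forall fun N => le_iSup (fun N => lpQuasiNorm p P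
        (gaussianSum γ (fun n => R (h n)) N)) N) tendsto_const_nhds
  have hlow : ∀ (p : ℝ) N, lpQuasiNorm p P (gaussianSum γ (fun n => R (h n)) N) ≤
      gammaNorm γ P p R.toLinearMap := fun p N =>
    lpQuasiNorm_gaussianSum_le_gammaNorm h.orthonormal p R.toLinearMap N
  have hall : R.toLinearMap ∈ gammaSumming H E γ P → ∀ p : ℝ, 0 < p →
      (⨆ N, lpQuasiNorm p P (gaussianSum γ (fun n => R (h n)) N)) < ∞ := fun hR p hp => by
    obtain ⟨C, hC, hle⟩ := hγ.exists_gammaNorm_le (H := H) r E two_pos hp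
    exact (iSup_le (hlow p)).trans_lt
      ((hle R.toLinearMap).trans_lt (ENNReal.mul_lt_top hC.lt_top hR))
  have hex : (∃ p : ℝ, 0 < p ∧
      (⨆ N, lpQuasiNorm p P (gaussianSum γ (fun n => R (h n)) N)) < ∞) →
      R.toLinearMap ∈ gammaSumming H E γ P := fun ⟨p, hp, hlt⟩ => by
    -- Domination is applied at the given exponent p; only afterwards does Kahane–Khintchine move to
    -- the exponent 2 of the definition.
    obtain ⟨C, hC, hle⟩ := hγ.exists_gammaNorm_le (H := H) r E hp two_pos
    exact (hle R.toLinearMap).trans_lt (ENNReal.mul_lt_top hC.lt_top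
      ((hsup p hp).trans_lt (ENNReal.mul_lt_top (gammaConst_ne_top r p).lt_top hlt)))
  have hlimit : R.toLinearMap ∈ gammaRadonifying H E γ P → ∃ S : Ω → E,
      (∀ᵐ ω ∂P, Tendsto (fun N => gaussianSum γ (fun n => R (h n)) N ω) atTop (𝓝 (S ω))) ∧
      ∀ q : ℝ, 0 < q → LpConvergesTo q P (gaussianSum γ (fun n => R (h n))) S := fun hR =>
    hγ.exists_limit r two_pos (hγ.lpCauchy_of_mem_gammaRadonifying r h.orthonormal hR)
  have hrad : (∃ p : ℝ, 0 < p ∧ LpConverges p P (gaussianSum γ (fun n => R (h n)))) →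
      R.toLinearMap ∈ gammaRadonifying H E γ P := fun ⟨p, hp, hconv⟩ =>
    hγ.mem_gammaRadonifying_of_lpCauchy r h
      (hγ.lpCauchy_of_lpCauchy r hp two_pos (hconv.lpCauchy r hp hmeas))
  have hradall : R.toLinearMap ∈ gammaRadonifying H E γ P →
      ∀ p : ℝ, 0 < p → LpConverges p P (gaussianSum γ (fun n => R (h n))) := fun hR p hp => by
    obtain ⟨S, -, hS⟩ := hlimit hR
    exact ⟨S, hS p hp⟩
  -- The exponent 1 is an arbitrary witness linking "for all p" to "for some p".
  refine ⟨⟨⟨fun hR => ⟨1, one_pos, hall hR 1 one_pos⟩, hex⟩,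
    ⟨hall, fun hp => hex ⟨1, one_pos, hp 1 one_pos⟩⟩,
    fun _ p hp => ⟨hlow p, hsup p hp⟩⟩,
    ⟨fun hR => ⟨1, one_pos, hradall hR 1 one_pos⟩, hrad⟩,
    ⟨hradall, fun hp => hrad ⟨1, one_pos, hp 1 one_pos⟩⟩, fun hR => ?_⟩
  obtain ⟨S, hae, hS⟩ := hlimit hR
  have hcont : Continuous fun x : E => ‖x‖ := IsRNormedSpace.continuous_norm r
  refine ⟨S, hae, fun p hp => ⟨hS p hp, ?_, ?_⟩⟩
  · exact lpQuasiNorm_le_of_tendsto hcont hcont.measurable hp hmeas hae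
      (Eventually.of_forall (hlow p)) tendsto_const_nhds
  · obtain ⟨c, hle, hc⟩ := exists_tendsto_of_lpConvergesTo r hp hmeas (hS p hp)
    exact hγ.gammaNorm_le_of_tendsto r h hp R (Eventually.of_forall hle) hc
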